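/- An MV-algebra is an abelian monoid $(A,\oplus,0)$ with a unary operation $\neg$ satisfying $\neg\neg x=x$, $x\oplus\neg 0=\neg 0$ and $x\oplus\neg(x\oplus\neg y)=y\oplus\neg(y\oplus\neg x)$. The real unit interval $[0,1]$ is an MV-algebra with $x\oplus y=\min\{x+y,1\}$ and $\neg x=1-x$. An MV-algebra is simple if its identity congruence is maximal among its proper congruences, and semisimple if it is a subdirect product of simple MV-algebras. A polyhedron in $\mathbb{R}^n$ is a finite (possibly empty) union of closed simplices. For a set $Y$, a set $X\subseteq[0,1]^Y$ is an infinite dimensional polyhedron if for every finite $Z\subseteq Y$ its image under the coordinate projection $[0,1]^Y\to[0,1]^Z$ is a polyhedron in $\mathbb{R}^Z$. A map $\xi\colon[0,1]^Y\to[0,1]$ is piecewise linear with integer coefficients if there are a finite $Y'\subseteq Y$ and a continuous $\xi'\colon[0,1]^{Y'}\to[0,1]$ such that $\xi(p)=\xi'(p|_{Y'})$ for all $p\in[0,1]^Y$, and finitely many affine functions $f_1,\dots,f_k\colon[0,1]^{Y'}\to\mathbb{R}$, whose coefficients and constant terms are integers, such that every $x\in[0,1]^{Y'}$ satisfies $\xi'(x)=f_i(x)$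 for some $i$. For a closed set $X\subseteq[0,1]^Y$ (product topology), $\mathcal{M}(X)$ denotes the MV-algebra, under pointwise operations, of all functions $X\to[0,1]$ that are restrictions to $X$ of piecewise linear maps $[0,1]^Y\to[0,1]$ with integer coefficients. An MV-algebra is polyhedral if it is isomorphic to $\mathcal{M}(X)$ for some set $Y$ and some closed $X\subseteq[0,1]^Y$ that is an infinite dimensional polyhedron. For an MV-algebra $A$, let $\mathcal{W}(A)\subseteq[0,1]^A$ be the set of all MV-algebra homomorphisms $A\to[0,1]$. Theorem. For every MV-algebra $A$ the following are equivalent: (i) $A$ is polyhedral; (ii) $A$ is semisimple and $\mathcal{W}(A)\subseteq[0,1]^A$ is an infinite dimensional polyhedron; (iii) every finitely generated subalgebra of $A$ is polyhedral. -/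

import Mathlib

universe u v w

/-- An MV-algebra: an abelian monoid `(A, ⊕, 0)` with an operation `¬` such that `¬¬x = x`,
`x ⊕ ¬0 = ¬0` and `x ⊕ ¬(x ⊕ ¬y) = y ⊕ ¬(y ⊕ ¬x)`. -/
class MVAlgebra (A : Type u) where
  oplus : A → A → A
  neg : A → A
  zero : A
  oplus_assoc : ∀ x y z, oplus (oplus x y) z = oplus x (oplus y z)
  oplus_comm : ∀ x y, oplus x y = oplus y x
  oplus_zero : ∀ x, oplus x zero = x
  neg_neg : ∀ x, neg (neg x) = x
  oplus_neg_zero : ∀ x, oplus x (neg zero) = neg zero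
  lukasiewicz : ∀ x y, oplus x (neg (oplus x (neg y))) = oplus y (neg (oplus y (neg x)))

namespace MVAlgebra

/-! ### Homomorphisms, products, subalgebras -/

/-- `f` is a homomorphism of MV-algebras. -/
structure IsHom {A : Type u} {B : Type v} [MVAlgebra A] [MVAlgebra B] (f : A → B) : Prop where
  map_zero : f zero = zero
  map_oplus : ∀ a b, f (oplus a b) = oplus (f a) (f b)
  map_neg : ∀ a, f (neg a) = neg (f a)

/-- `A` and `B` are isomorphic MV-algebras. -/
def Isomorphic (A : Type u) (B : Type v) [MVAlgebra A] [MVAlgebra B] : Prop :=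
  ∃ f : A → B, IsHom f ∧ Function.Bijective f

/-- The standard MV-algebra on the real unit interval: `x ⊕ y = min (x + y) 1`, `¬x = 1 - x`. -/
instance instUnitInterval : MVAlgebra unitInterval where
  oplus x y := ⟨min ((x : ℝ) + y) 1, le_min (add_nonneg x.2.1 y.2.1) zero_le_one, min_le_right _ _⟩
  neg x := ⟨1 - (x : ℝ), sub_nonneg.2 x.2.2, sub_le_self _ x.2.1⟩
  zero := ⟨0, le_refl _, zero_le_one⟩
  oplus_assoc x y z := by
    apply Subtype.ext
    have hx := x.2.1
    have hz := z.2.1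
    simp only
    rcases le_total ((x : ℝ) + y) 1 with h | h <;> rcases le_total ((y : ℝ) + z) 1 with h' | h'
    · rw [min_eq_left h, min_eq_left h', add_assoc]
    · rw [min_eq_left h, min_eq_right h', min_eq_right (by linarith), min_eq_right (by linarith)]
    · rw [min_eq_right h, min_eq_left h', min_eq_right (by linarith), min_eq_right (by linarith)]
    · rw [min_eq_right h, min_eq_right h', min_eq_right (by linarith), min_eq_right (by linarith)]
  oplus_comm x y := by
    apply Subtype.ext
    simp only [add_comm]
  oplus_zero x := by
    apply Subtype.ext
    simp only [add_zero]
    exact min_eq_left x.2.2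
  neg_neg x := by
    apply Subtype.ext
    simp
  oplus_neg_zero x := by
    apply Subtype.ext
    have hx := x.2.1
    simp only [sub_zero]
    exact min_eq_right (by linarith)
  lukasiewicz x y := by
    apply Subtype.ext
    have hx := x.2
    have hy := y.2
    simp only [Set.mem_Icc] at hx hy
    simp only
    rcases le_total (x : ℝ) y with h | h
    · rw [min_eq_left (by linarith : (x : ℝ) + (1 - y) ≤ 1),
        min_eq_right (by linarith : (1 : ℝ) ≤ y + (1 - x))]
      ring_nf
    · rw [min_eq_right (by linarith : (1 : ℝ) ≤ x + (1 - y)),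
        min_eq_left (by linarith : (y : ℝ) + (1 - x) ≤ 1)]
      ring_nf

/-- The product of a family of MV-algebras, with pointwise operations. -/
instance instPi {ι : Type v} (B : ι → Type w) [∀ i, MVAlgebra (B i)] : MVAlgebra (∀ i, B i) where
  oplus x y i := oplus (x i) (y i)
  neg x i := neg (x i)
  zero _ := zero
  oplus_assoc _ _ _ := funext fun _ => oplus_assoc _ _ _
  oplus_comm _ _ := funext fun _ => oplus_comm _ _
  oplus_zero _ := funext fun _ => oplus_zero _
  neg_neg _ := funext fun _ => neg_neg _
  oplus_neg_zero _ := funext fun _ => oplus_neg_zero _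
  lukasiewicz _ _ := funext fun _ => lukasiewicz _ _

/-- A subalgebra of an MV-algebra. -/
structure Subalgebra (A : Type u) [MVAlgebra A] where
  carrier : Set A
  zero_mem : zero ∈ carrier
  oplus_mem : ∀ a b, a ∈ carrier → b ∈ carrier → oplus a b ∈ carrier
  neg_mem : ∀ a, a ∈ carrier → neg a ∈ carrier

namespace Subalgebra

instance instMVAlgebra {A : Type u} [MVAlgebra A] (S : Subalgebra A) : MVAlgebra S.carrier where
  oplus x y := ⟨oplus x.1 y.1, S.oplus_mem _ _ x.2 y.2⟩
  neg x := ⟨neg x.1, S.neg_mem _ x.2⟩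
  zero := ⟨zero, S.zero_mem⟩
  oplus_assoc _ _ _ := Subtype.ext (oplus_assoc _ _ _)
  oplus_comm _ _ := Subtype.ext (oplus_comm _ _)
  oplus_zero _ := Subtype.ext (oplus_zero _)
  neg_neg _ := Subtype.ext (neg_neg _)
  oplus_neg_zero _ := Subtype.ext (oplus_neg_zero _)
  lukasiewicz _ _ := Subtype.ext (lukasiewicz _ _)

/-- The subalgebra generated by a subset `C`: the intersection of all subalgebras containing it. -/
def generatedBy {A : Type u} [MVAlgebra A] (C : Set A) : Subalgebra A where
  carrier := {a | ∀ T : Subalgebra A, C ⊆ T.carrier → a ∈ T.carrier}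
  zero_mem T _ := T.zero_mem
  oplus_mem a b ha hb T hT := T.oplus_mem a b (ha T hT) (hb T hT)
  neg_mem a ha T hT := T.neg_mem a (ha T hT)

/-- The subalgebra `S` is finitely generated. -/
def IsFinitelyGenerated {A : Type u} [MVAlgebra A] (S : Subalgebra A) : Prop :=
  ∃ C : Set A, C.Finite ∧ S = generatedBy C

end Subalgebra

/-! ### Congruences, simple and semisimple algebras -/

/-- A congruence of an MV-algebra. -/
structure Congruence (A : Type u) [MVAlgebra A] where
  rel : A → A → Prop
  equivalence : Equivalence rel
  rel_oplus : ∀ a a' b b', rel a a' → rel b b' → rel (oplus a b) (oplus a' b')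
  rel_neg : ∀ a a', rel a a' → rel (neg a) (neg a')

/-- The identity congruence. -/
def Congruence.identity (A : Type u) [MVAlgebra A] : Congruence A where
  rel a b := a = b
  equivalence := eq_equivalence
  rel_oplus := by rintro a _ b _ rfl rfl; rfl
  rel_neg := by rintro a _ rfl; rfl

/-- A congruence is proper if it does not identify all elements. -/
def Congruence.IsProper {A : Type u} [MVAlgebra A] (θ : Congruence A) : Prop :=
  ∃ a b, ¬ θ.rel a b

/-- A congruence is maximal if it is maximal in the poset of proper congruences. -/
def Congruence.IsMaximal {A : Type u} [MVAlgebra A] (θ : Congruence A) : Prop :=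
  θ.IsProper ∧ ∀ ψ : Congruence A, ψ.IsProper →
    (∀ a b, θ.rel a b → ψ.rel a b) → ∀ a b, ψ.rel a b → θ.rel a b

/-- An MV-algebra is simple if its identity congruence is maximal. -/
def IsSimple (A : Type u) [MVAlgebra A] : Prop :=
  (Congruence.identity A).IsMaximal

/-- An MV-algebra is semisimple if it is a subdirect product of simple MV-algebras.  The index
set and the factors may be taken in the universe of `A`, because the factors are quotients of `A`
and the index set may be taken to be a set of congruences of `A`. -/
def IsSemisimple (A : Type u) [MVAlgebra A] : Prop :=
  ∃ (ι : Type u) (B : ι → Type u) (_ : ∀ i, MVAlgebra (B i)),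
    (∀ i, IsSimple (B i)) ∧
    ∃ f : A → ∀ i, B i, IsHom f ∧ Function.Injective f ∧
      ∀ i, Function.Surjective fun a => f a i

/-! ### The dual space -/

/-- The dual space `W(A) = Hom(A, [0,1])`, as a subset of the Tychonoff cube `[0,1]^A`. -/
def dualSpace (A : Type u) [MVAlgebra A] : Set (A → unitInterval) :=
  {p | IsHom p}

end MVAlgebra

/-! ### Polyhedra -/

/-- A simplex in `ℝ^ι`: the convex hull of a finite nonempty affinely independent set. -/
def IsSimplex {ι : Type u} (S : Set (ι → ℝ)) : Prop :=
  ∃ V : Finset (ι → ℝ), V.Nonempty ∧ AffineIndependent ℝ ((↑) : V → ι → ℝ) ∧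
    S = convexHull ℝ (V : Set (ι → ℝ))

/-- A polyhedron in `ℝ^ι` (for finite `ι`): a finite (possibly empty) union of simplices. -/
def IsPolyhedron {ι : Type u} [Finite ι] (P : Set (ι → ℝ)) : Prop :=
  ∃ T : Set (Set (ι → ℝ)), T.Finite ∧ (∀ S ∈ T, IsSimplex S) ∧ P = ⋃₀ T

/-- The projection `[0,1]^Y → [0,1]^Z` for finite `Z ⊆ Y`, followed by the inclusion
`[0,1]^Z ⊆ ℝ^Z`. -/
def cubeProj {Y : Type u} (Z : Finset Y) (p : Y → unitInterval) : Z → ℝ :=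
  fun z => (p z : ℝ)

/-- `X ⊆ [0,1]^Y` is a (possibly infinite dimensional) polyhedron if all its projections to
finitely many coordinates are polyhedra. -/
def IsInfinitePolyhedron {Y : Type u} (X : Set (Y → unitInterval)) : Prop :=
  ∀ Z : Finset Y, IsPolyhedron (cubeProj Z '' X)

/-! ### Piecewise linear maps with integer coefficients and the algebra `M(X)` -/

/-- `f : [0,1]^J → [0,1]`, `J` finite, is a continuous piecewise linear map with integer
coefficients: there are finitely many affine functions with integer coefficients such that `f`
agrees at every point with one of them. A pair `c = (c.1, c.2)` stands for the affine function
`x ↦ ∑ j, c.1 j * x j + c.2`. -/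
def IsIntPiecewiseLinear {J : Type u} [Fintype J] (f : (J → unitInterval) → unitInterval) : Prop :=
  Continuous f ∧ ∃ F : Finset ((J → ℤ) × ℤ), ∀ x : J → unitInterval,
    ∃ c ∈ F, (f x : ℝ) = ∑ j, (c.1 j : ℝ) * (x j : ℝ) + (c.2 : ℝ)

/-- `f : [0,1]^I → [0,1]`, `I` arbitrary, is piecewise linear with integer coefficients if it
factors through such a map on a cube `[0,1]^I'` with `I' ⊆ I` finite. -/
def IsIntPiecewiseLinearOnCube {I : Type u} (f : (I → unitInterval) → unitInterval) : Prop :=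
  ∃ (I' : Finset I) (f' : (I' → unitInterval) → unitInterval),
    IsIntPiecewiseLinear f' ∧ ∀ p, f p = f' (fun i => p i)

/-- A `ℤ`-map from `X ⊆ [0,1]^I` to `[0,1]`: the restriction to `X` of a piecewise linear map with
integer coefficients on the cube. -/
def IsZMap {I : Type u} (X : Set (I → unitInterval)) (g : X → unitInterval) : Prop :=
  ∃ ξ : (I → unitInterval) → unitInterval, IsIntPiecewiseLinearOnCube ξ ∧
    ∀ p : X, g p = ξ p

namespace IsIntPiecewiseLinear

theorem zero {J : Type u} [Fintype J] :
    IsIntPiecewiseLinear (fun _ : J → unitInterval => (MVAlgebra.zero : unitInterval)) :=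
  ⟨continuous_const, {(0, 0)}, fun x => ⟨(0, 0), by simp, by simp [MVAlgebra.zero]⟩⟩

theorem neg {J : Type u} [Fintype J] {f : (J → unitInterval) → unitInterval}
    (hf : IsIntPiecewiseLinear f) : IsIntPiecewiseLinear (fun x => MVAlgebra.neg (f x)) := by
  classical
  obtain ⟨hc, F, hF⟩ := hf
  refine ⟨?_, F.image fun c => (-c.1, 1 - c.2), fun x => ?_⟩
  · exact Continuous.subtype_mk (continuous_const.sub (continuous_subtype_val.comp hc)) _
  · obtain ⟨c, hcF, hx⟩ := hF x
    refine ⟨_, Finset.mem_image_of_mem _ hcF, ?_⟩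
    change 1 - (f x : ℝ) = _
    rw [hx]
    simp only [Pi.neg_apply, Int.cast_neg, neg_mul, Finset.sum_neg_distrib, Int.cast_sub,
      Int.cast_one]
    ring

theorem oplus {J : Type u} [Fintype J] {f g : (J → unitInterval) → unitInterval}
    (hf : IsIntPiecewiseLinear f) (hg : IsIntPiecewiseLinear g) :
    IsIntPiecewiseLinear (fun x => MVAlgebra.oplus (f x) (g x)) := by
  classical
  obtain ⟨hfc, F, hF⟩ := hf
  obtain ⟨hgc, G, hG⟩ := hg
  refine ⟨?_, insert (0, 1) ((F ×ˢ G).image fun c => (c.1.1 + c.2.1, c.1.2 + c.2.2)),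
    fun x => ?_⟩
  · exact Continuous.subtype_mk
      (((continuous_subtype_val.comp hfc).add (continuous_subtype_val.comp hgc)).min
        continuous_const) _
  · obtain ⟨c, hcF, hx⟩ := hF x
    obtain ⟨d, hdG, hy⟩ := hG x
    rcases le_total ((f x : ℝ) + g x) 1 with h | h
    · refine ⟨(c.1 + d.1, c.2 + d.2), Finset.mem_insert_of_mem
        (Finset.mem_image.2 ⟨(c, d), Finset.mk_mem_product hcF hdG, rfl⟩), ?_⟩
      change min ((f x : ℝ) + g x) 1 = _
      rw [min_eq_left h, hx, hy]
      simp only [Pi.add_apply, Int.cast_add, add_mul, Finset.sum_add_distrib]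
      ring
    · refine ⟨(0, 1), Finset.mem_insert_self _ _, ?_⟩
      change min ((f x : ℝ) + g x) 1 = _
      rw [min_eq_right h]
      simp

/-- Enlarging the finite set of variables. -/
theorem extend {I : Type u} {I₁ I₂ : Finset I} (h : I₁ ⊆ I₂)
    {f : (I₁ → unitInterval) → unitInterval} (hf : IsIntPiecewiseLinear f) :
    IsIntPiecewiseLinear (fun x : I₂ → unitInterval => f (fun i => x ⟨i, h i.2⟩)) := by
  classical
  obtain ⟨hc, F, hF⟩ := hf
  refine ⟨hc.comp (continuous_pi fun i => continuous_apply _),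
    F.image fun c => (fun j => if hj : (j : I) ∈ I₁ then c.1 ⟨j, hj⟩ else 0, c.2), fun x => ?_⟩
  obtain ⟨c, hcF, hx⟩ := hF fun i => x ⟨i, h i.2⟩
  refine ⟨_, Finset.mem_image_of_mem _ hcF, ?_⟩
  rw [hx]
  congr 1
  refine Finset.sum_of_injOn (fun i : I₁ => (⟨i, h i.2⟩ : I₂)) ?_ ?_ ?_ ?_
  · intro a _ b _ hab
    exact Subtype.ext (congrArg (fun t : I₂ => (t : I)) hab)
  · intro a _
    simp
  · intro j _ hj
    have : (j : I) ∉ I₁ := fun hj' => hj ⟨⟨j, hj'⟩, by simp, rfl⟩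
    simp [this]
  · intro i _
    simp

end IsIntPiecewiseLinear

/-- The MV-algebra `M(X)` of all `ℤ`-maps from `X ⊆ [0,1]^I` to `[0,1]`, a subalgebra of
`[0,1]^X`. -/
def McN {I : Type u} (X : Set (I → unitInterval)) : MVAlgebra.Subalgebra (X → unitInterval) where
  carrier := {g | IsZMap X g}
  zero_mem := ⟨fun _ => MVAlgebra.zero, ⟨∅, _, IsIntPiecewiseLinear.zero, fun _ => rfl⟩,
    fun _ => rfl⟩
  oplus_mem := by
    classical
    rintro g₁ g₂ ⟨ξ₁, ⟨I₁, f₁, hf₁, h₁⟩, hg₁⟩ ⟨ξ₂, ⟨I₂, f₂, hf₂, h₂⟩, hg₂⟩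
    refine ⟨fun p => MVAlgebra.oplus (ξ₁ p) (ξ₂ p), ⟨I₁ ∪ I₂, _,
      (hf₁.extend Finset.subset_union_left).oplus (hf₂.extend Finset.subset_union_right),
      fun p => ?_⟩, fun p => ?_⟩
    · simp only [h₁, h₂]
    · simp only [← hg₁, ← hg₂]
      rfl
  neg_mem := by
    rintro g ⟨ξ, ⟨I', f, hf, h⟩, hg⟩
    refine ⟨fun p => MVAlgebra.neg (ξ p), ⟨I', _, hf.neg, fun p => ?_⟩, fun p => ?_⟩
    · simp only [h]
    · simp only [← hg]
      rfl

/-- An MV-algebra is polyhedral if it is isomorphic to `M(X)` for a closed subspace `X` of some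
Tychonoff cube that is a (possibly infinite dimensional) polyhedron. -/
def MVAlgebra.IsPolyhedral (A : Type u) [MVAlgebra A] : Prop :=
  ∃ (Y : Type u) (X : Set (Y → unitInterval)), IsClosed X ∧ IsInfinitePolyhedron X ∧
    MVAlgebra.Isomorphic A (McN X).carrier

/-! By McNaughton's theorem (`IsIntPiecewiseLinear.exists_term`) the elements of `McN X` are exactly
restrictions of MV-terms, so everything can be computed by evaluating terms under homomorphisms to
`[0,1]`. Its proof is a max-min formula in truncated integer affine functions.

The main lever is `exists_mem_eq_of_isHom`. Let a compact set `X` of homomorphisms `A → [0,1]`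
separate the points of `A`, and let `h` be a homomorphism to `[0,1]` from a subalgebra. If `h`
disagreed with all of `X` on a finite tuple `z`, then `h(z)` would lie outside a compact subset of a
finite cube, and some term would vanish on that set but not at `h(z)`. Separation makes this term
zero at `z` in `A`, a contradiction. Hence (`image_dualSpace_eq`) the finite projections of a dual
space can be computed from any compact separating set, and those of a subalgebra's dual space from
the dual of the whole algebra.

For `A` isomorphic to `McN X`, the points of `X` form such a set, so the finite projections of the
dual space are images of `X` under finitely many terms. Terms are piecewise affine, and images of
polyhedra under them are polyhedra (`IsPolyhedron.image_realEval`). Conversely, an algebra whose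
homomorphisms to `[0,1]` separate points is `McN` of its dual space. That this separation property
is semisimplicity (`isSemisimple_iff`) needs the embedding of simple algebras into `[0,1]`: a simple
algebra is an Archimedean chain, Chang's construction makes it the unit interval of an Archimedean
ordered group, and Hölder's theorem embeds that group into the reals.

Polyhedrality then passes to subalgebras by restricting homomorphisms. Conversely, a finite
projection of the dual space of `A` only sees the subalgebra generated by the coordinates in
question, and semisimplicity is itself local by compactness of the cube. -/

/-! ### MV-terms -/

/-- MV-terms over a set `J` of variables. -/
inductive MVTerm (J : Type u) : Type u
  | var (j : J) : MVTerm J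
  | zero : MVTerm J
  | oplus (s t : MVTerm J) : MVTerm J
  | neg (t : MVTerm J) : MVTerm J

namespace MVTerm

/-- The value of a term in an MV-algebra. -/
def eval {J : Type u} {A : Type v} [MVAlgebra A] (x : J → A) : MVTerm J → A
  | var j => x j
  | zero => MVAlgebra.zero
  | oplus s t => MVAlgebra.oplus (s.eval x) (t.eval x)
  | neg t => MVAlgebra.neg (t.eval x)

/-- The real function defined by a term, on all of `ℝ^J`. -/
def realEval {J : Type u} (x : J → ℝ) : MVTerm J → ℝ
  | var j => x j
  | zero => 0
  | oplus s t => min (s.realEval x + t.realEval x) 1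
  | neg t => 1 - t.realEval x

theorem coe_eval {J : Type u} (x : J → unitInterval) (t : MVTerm J) :
    ((t.eval x : unitInterval) : ℝ) = t.realEval fun j => (x j : ℝ) := by
  induction t with
  | var j => rfl
  | zero => rfl
  | oplus s t hs ht =>
    rw [realEval, ← hs, ← ht]
    rfl
  | neg t ht =>
    rw [realEval, ← ht]
    rfl

theorem _root_.MVAlgebra.IsHom.map_eval {J : Type u} {A : Type v} {B : Type w} [MVAlgebra A]
    [MVAlgebra B] {f : A → B} (hf : MVAlgebra.IsHom f) (x : J → A) (t : MVTerm J) :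
    f (t.eval x) = t.eval fun j => f (x j) := by
  induction t with
  | var j => rfl
  | zero => exact hf.map_zero
  | oplus s t hs ht => rw [eval, hf.map_oplus, hs, ht]; rfl
  | neg t ht => rw [eval, hf.map_neg, ht]; rfl

/-- Renaming of variables. -/
def rename {J : Type u} {K : Type v} (f : J → K) : MVTerm J → MVTerm K
  | var j => var (f j)
  | zero => zero
  | oplus s t => oplus (s.rename f) (t.rename f)
  | neg t => neg (t.rename f)

theorem eval_rename {J : Type u} {K : Type v} {A : Type w} [MVAlgebra A] (f : J → K) (x : K → A)
    (t : MVTerm J) : (t.rename f).eval x = t.eval fun j => x (f j) := by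
  induction t with
  | var j => rfl
  | zero => rfl
  | oplus s t hs ht => rw [rename, eval, hs, ht]; rfl
  | neg t ht => rw [rename, eval, ht]; rfl

/-- A term only involves finitely many variables. -/
theorem exists_finset {J : Type u} (t : MVTerm J) :
    ∃ s : Finset J, ∀ s' : Finset J, s ⊆ s' → ∃ t' : MVTerm s', t = t'.rename (↑) := by
  classical
  induction t with
  | var j => exact ⟨{j}, fun s' h => ⟨var ⟨j, h (Finset.mem_singleton_self j)⟩, rfl⟩⟩
  | zero => exact ⟨∅, fun s' _ => ⟨zero, rfl⟩⟩
  | oplus s t hs ht =>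
    obtain ⟨a, ha⟩ := hs
    obtain ⟨b, hb⟩ := ht
    refine ⟨a ∪ b, fun s' h => ?_⟩
    obtain ⟨s₁, rfl⟩ := ha s' (Finset.union_subset_left h)
    obtain ⟨t₁, rfl⟩ := hb s' (Finset.union_subset_right h)
    exact ⟨oplus s₁ t₁, rfl⟩
  | neg t ht =>
    obtain ⟨a, ha⟩ := ht
    refine ⟨a, fun s' h => ?_⟩
    obtain ⟨t₁, rfl⟩ := ha s' h
    exact ⟨neg t₁, rfl⟩

end MVTerm

/-! ### Term functions on cubes -/

/-- The real function `f` on the cube `[0,1]^J` is defined by an MV-term. -/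
def IsTermFun {J : Type u} (f : (J → unitInterval) → ℝ) : Prop :=
  ∃ t : MVTerm J, ∀ x, f x = t.eval x

namespace IsTermFun

variable {J : Type u} {f g : (J → unitInterval) → ℝ}

theorem nonneg (hf : IsTermFun f) (x : J → unitInterval) : 0 ≤ f x := by
  obtain ⟨t, ht⟩ := hf
  rw [ht]
  exact (t.eval x).2.1

theorem le_one (hf : IsTermFun f) (x : J → unitInterval) : f x ≤ 1 := by
  obtain ⟨t, ht⟩ := hf
  rw [ht]
  exact (t.eval x).2.2

theorem coord (j : J) : IsTermFun fun x : J → unitInterval => (x j : ℝ) :=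
  ⟨.var j, fun _ => rfl⟩

theorem const_zero : IsTermFun fun _ : J → unitInterval => (0 : ℝ) :=
  ⟨.zero, fun _ => rfl⟩

theorem one_sub (hf : IsTermFun f) : IsTermFun fun x => 1 - f x := by
  obtain ⟨t, ht⟩ := hf
  exact ⟨.neg t, fun x => by beta_reduce; rw [ht]; rfl⟩

theorem const_one : IsTermFun fun _ : J → unitInterval => (1 : ℝ) := by
  simpa using (const_zero (J := J)).one_sub

theorem min_add_one (hf : IsTermFun f) (hg : IsTermFun g) :
    IsTermFun fun x => min (f x + g x) 1 := by
  obtain ⟨s, hs⟩ := hf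
  obtain ⟨t, ht⟩ := hg
  exact ⟨.oplus s t, fun x => by beta_reduce; rw [hs, ht]; rfl⟩

theorem max_add_sub_one (hf : IsTermFun f) (hg : IsTermFun g) :
    IsTermFun fun x => max (f x + g x - 1) 0 := by
  convert (hf.one_sub.min_add_one hg.one_sub).one_sub using 2 with x
  rcases le_total (f x + g x) 1 with h | h
  · rw [max_eq_right (by linarith), min_eq_right (by linarith)]; ring
  · rw [max_eq_left (by linarith), min_eq_left (by linarith)]; ring

/-- Adding the truncated difference `f - g` back to `g` gives the maximum. -/
theorem sup (hf : IsTermFun f) (hg : IsTermFun g) : IsTermFun (f ⊔ g) := by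
  convert (hf.max_add_sub_one hg.one_sub).min_add_one hg using 1
  ext x
  have := hf.le_one x
  have := hg.le_one x
  simp only [Pi.sup_apply]
  rcases le_total (f x) (g x) with h | h
  · rw [sup_eq_right.2 h, max_eq_right (by linarith), min_eq_left (by linarith)]; ring
  · rw [sup_eq_left.2 h, max_eq_left (by linarith), min_eq_left (by linarith)]; ring

theorem inf (hf : IsTermFun f) (hg : IsTermFun g) : IsTermFun (f ⊓ g) := by
  convert (hf.one_sub.sup hg.one_sub).one_sub using 1
  ext x
  simp only [Pi.sup_apply, Pi.inf_apply]
  rcases le_total (f x) (g x) with h | h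
  · rw [inf_eq_left.2 h, sup_eq_left.2 (by linarith)]; ring
  · rw [inf_eq_right.2 h, sup_eq_right.2 (by linarith)]; ring

end IsTermFun

/-! ### Truncations of integer affine functions -/

/-- Truncation of a real number to `[0,1]`. -/
def unitTrunc (r : ℝ) : ℝ := max 0 (min r 1)

theorem unitTrunc_mono : Monotone unitTrunc := fun _ _ h =>
  max_le_max le_rfl (min_le_min h le_rfl)

theorem unitTrunc_of_mem {r : ℝ} (h : 0 ≤ r) (h' : r ≤ 1) : unitTrunc r = r := by
  rw [unitTrunc, min_eq_left h', max_eq_right h]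

theorem unitTrunc_of_nonpos {r : ℝ} (h : r ≤ 0) : unitTrunc r = 0 := by
  rw [unitTrunc, min_eq_left (h.trans zero_le_one), max_eq_left h]

theorem unitTrunc_of_one_le {r : ℝ} (h : 1 ≤ r) : unitTrunc r = 1 := by
  rw [unitTrunc, min_eq_right h, max_eq_right zero_le_one]

theorem unitTrunc_one_sub (r : ℝ) : unitTrunc (1 - r) = 1 - unitTrunc r := by
  rcases le_total r 0 with h | h
  · rw [unitTrunc_of_nonpos h, unitTrunc_of_one_le (by linarith)]; ring
  rcases le_total r 1 with h' | h'
  · rw [unitTrunc_of_mem h h', unitTrunc_of_mem (by linarith) (by linarith)]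
  · rw [unitTrunc_of_one_le h', unitTrunc_of_nonpos (by linarith)]; ring

/-- Only one of the two truncations on the right matters at a time: for `r ≤ 0` the truncation of
`r` is `0`, for `r ≥ 0` that of `r + 1` is `1`. This lets a coordinate be added outside the
truncation using MV-operations alone. -/
theorem unitTrunc_add {r x : ℝ} (hx : 0 ≤ x) (hx' : x ≤ 1) :
    unitTrunc (r + x) = max (min (unitTrunc r + x) 1 + unitTrunc (r + 1) - 1) 0 := by
  rcases le_total r 0 with h | h
  · rw [unitTrunc_of_nonpos h, zero_add, min_eq_left hx']
    rcases le_total r (-1) with h' | h'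
    · rw [unitTrunc_of_nonpos (by linarith), unitTrunc_of_nonpos (by linarith),
        max_eq_right (by linarith)]
    · rw [unitTrunc_of_mem (r := r + 1) (by linarith) (by linarith), unitTrunc,
        min_eq_left (by linarith), max_comm]
      ring_nf
  · rw [unitTrunc_of_one_le (r := r + 1) (by linarith)]
    rcases le_total r 1 with h' | h'
    · rw [unitTrunc_of_mem h h', unitTrunc, max_comm]
      ring_nf
    · rw [unitTrunc_of_one_le h', unitTrunc_of_one_le (by linarith), min_eq_right (by linarith)]
      norm_num

/-- All integer translates of the real function `f` have truncations defined by terms. -/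
def HasTermTruncations {J : Type u} (f : (J → unitInterval) → ℝ) : Prop :=
  ∀ k : ℤ, IsTermFun fun x => unitTrunc (f x + k)

namespace HasTermTruncations

variable {J : Type u} {f : (J → unitInterval) → ℝ}

theorem const_zero : HasTermTruncations fun _ : J → unitInterval => (0 : ℝ) := by
  intro k
  rcases le_or_gt k 0 with h | h
  · convert IsTermFun.const_zero using 2
    exact unitTrunc_of_nonpos (by simpa using h)
  · convert IsTermFun.const_one using 2
    exact unitTrunc_of_one_le (by rw [zero_add]; exact_mod_cast h)

/-- The translate by `k` of the new function needs the translates by `k` and `k + 1` of the old one,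
which is why the induction has to carry all integer translates. -/
theorem add_coord (hf : HasTermTruncations f) (j : J) :
    HasTermTruncations fun x => f x + x j := by
  intro k
  convert ((hf k).min_add_one (IsTermFun.coord j)).max_add_sub_one (hf (k + 1)) using 2 with x
  rw [add_right_comm, unitTrunc_add (x j).2.1 (x j).2.2]
  push_cast
  ring_nf

theorem neg (hf : HasTermTruncations f) : HasTermTruncations fun x => -f x := by
  intro k
  convert (hf (1 - k)).one_sub using 2 with x
  rw [← unitTrunc_one_sub]
  push_cast
  ring_nf

theorem add_nat_mul_coord (hf : HasTermTruncations f) (j : J) (n : ℕ) :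
    HasTermTruncations fun x => f x + n * x j := by
  induction n with
  | zero => simpa using hf
  | succ n ih =>
    convert ih.add_coord j using 2 with x
    push_cast
    ring

theorem add_int_mul_coord (hf : HasTermTruncations f) (j : J) (n : ℤ) :
    HasTermTruncations fun x => f x + n * x j := by
  rcases n.eq_nat_or_neg with ⟨m, rfl | rfl⟩
  · simpa using hf.add_nat_mul_coord j m
  · convert (hf.neg.add_nat_mul_coord j m).neg using 2 with x
    push_cast
    ring

theorem sum_int_mul_coord (s : Finset J) (c : J → ℤ) :
    HasTermTruncations fun x : J → unitInterval => ∑ j ∈ s, (c j : ℝ) * x j := by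
  classical
  induction s using Finset.induction_on with
  | empty => simpa using const_zero
  | insert j s hj ih =>
    convert ih.add_int_mul_coord j (c j) using 2 with x
    rw [Finset.sum_insert hj, add_comm]

end HasTermTruncations

/-! ### McNaughton's theorem -/

/-- The value at `x` of the affine function with coefficients `c`. -/
def intAffine {J : Type u} [Fintype J] (c : (J → ℤ) × ℤ) (x : J → unitInterval) : ℝ :=
  ∑ j, (c.1 j : ℝ) * (x j : ℝ) + (c.2 : ℝ)

theorem isTermFun_unitTrunc_intAffine {J : Type u} [Fintype J] (c : (J → ℤ) × ℤ) :
    IsTermFun fun x => unitTrunc (intAffine c x) :=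
  HasTermTruncations.sum_int_mul_coord Finset.univ c.1 c.2

/-- A piece that differs from `φ` at `s` differs from it on a neighbourhood, and there are only
finitely many pieces. -/
theorem eventually_exists_active {T : Type u} {κ : Type v} [TopologicalSpace T] {φ : T → ℝ}
    (hφ : Continuous φ) (G : Finset κ) {ψ : κ → T → ℝ} (hψ : ∀ k, Continuous (ψ k)) (s : T) :
    ∀ᶠ t in nhds s, ∀ k ∈ G, φ t = ψ k t → φ s = ψ k s := by
  rw [Filter.eventually_all_finset]
  intro k _
  by_cases h : φ s = ψ k s
  · exact Filter.Eventually.of_forall fun _ _ => h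
  · filter_upwards [(isOpen_ne_fun hφ (hψ k)).mem_nhds h] with t ht h'
    exact absurd h' ht

/-- A continuous function on an interval that is at every point equal to one of finitely many
affine functions is, at the two end points, crossed upwards by one of them. -/
theorem exists_affine_le_ge {φ : ℝ → ℝ} (hφ : Continuous φ) (G : Finset (ℝ × ℝ))
    (hG : ∀ t, 0 ≤ t → t ≤ 1 → ∃ c ∈ G, φ t = c.1 + c.2 * t) :
    ∃ c ∈ G, c.1 ≤ φ 0 ∧ φ 1 ≤ c.1 + c.2 := by
  by_contra! hcon
  set a := φ 0 with ha
  set b := φ 1 with hb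
  have hψ : ∀ c : ℝ × ℝ, Continuous fun t : ℝ => c.1 + c.2 * t := fun c => by fun_prop
  -- just after `0` the function lies below the chord
  obtain ⟨t₀, ht₀, ht₀', hlt⟩ : ∃ t₀, 0 < t₀ ∧ t₀ < 1 ∧ φ t₀ < a + (b - a) * t₀ := by
    have h1 : ∀ᶠ t in nhdsWithin (0 : ℝ) (Set.Ioi 0), t < 1 :=
      nhdsWithin_le_nhds (gt_mem_nhds zero_lt_one)
    have h2 := (eventually_exists_active hφ G hψ 0).filter_mono
      (nhdsWithin_le_nhds (s := Set.Ioi (0 : ℝ)))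
    obtain ⟨t, ⟨ht1, ht2⟩, ht0⟩ := ((h1.and h2).and self_mem_nhdsWithin).exists
    have ht0 : 0 < t := ht0
    refine ⟨t, ht0, ht1, ?_⟩
    obtain ⟨c, hc, hct⟩ := hG t ht0.le ht1.le
    have h0 := ht2 c hc hct
    simp only [mul_zero, add_zero] at h0
    have h3 := hcon c hc h0.ge
    rw [hct, ← h0]
    nlinarith
  -- the first return to the chord
  set S := {t : ℝ | t ∈ Set.Icc t₀ 1 ∧ a + (b - a) * t ≤ φ t} with hS
  have hSc : IsCompact S := by
    refine isCompact_Icc.inter_right (isClosed_le (by fun_prop) hφ)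
  have hSn : S.Nonempty := ⟨1, ⟨ht₀'.le, le_rfl⟩, by simp [hb]⟩
  obtain ⟨s, hs, hmin⟩ := hSc.exists_isLeast hSn
  obtain ⟨⟨hs0, hs1⟩, hs2⟩ := hs
  have hs0' : t₀ < s := lt_of_le_of_ne hs0 (by rintro rfl; linarith)
  have hbelow : ∀ t, t₀ ≤ t → t < s → φ t < a + (b - a) * t := fun t h h' => by
    by_contra! h''
    exact absurd (hmin ⟨⟨h, by linarith⟩, h''⟩) (not_le.2 h')
  have hev : ∀ᶠ t in nhdsWithin s (Set.Iio s), t₀ < t :=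
    nhdsWithin_le_nhds (lt_mem_nhds hs0')
  have hs3 : φ s ≤ a + (b - a) * s := by
    have hc1 : Filter.Tendsto φ (nhdsWithin s (Set.Iio s)) (nhds (φ s)) :=
      hφ.continuousAt.tendsto.mono_left nhdsWithin_le_nhds
    have hc2 : Filter.Tendsto (fun t => a + (b - a) * t) (nhdsWithin s (Set.Iio s))
        (nhds (a + (b - a) * s)) :=
      (Continuous.continuousAt (by fun_prop)).tendsto.mono_left nhdsWithin_le_nhds
    refine le_of_tendsto_of_tendsto hc1 hc2 ?_
    filter_upwards [hev, self_mem_nhdsWithin] with t h1 h2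
    exact (hbelow t h1.le h2).le
  have hs4 : φ s = a + (b - a) * s := le_antisymm hs3 hs2
  -- A piece active just before `s` meets the chord at `s` from below, so it is steeper than the
  -- chord. It therefore starts below `a` and ends at or above `b`, contrary to `hcon`.
  obtain ⟨t, ⟨ht1, ht2⟩, hts⟩ := ((hev.and ((eventually_exists_active hφ G hψ s).filter_mono
    (nhdsWithin_le_nhds (s := Set.Iio s)))).and self_mem_nhdsWithin).exists
  have hts : t < s := hts
  obtain ⟨c, hc, hct⟩ := hG t (by linarith) (by linarith)
  have h5 := ht2 c hc hct
  have h6 := hbelow t ht1.le hts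
  have h7 : (b - a - c.2) * (s - t) < 0 := by nlinarith
  have h8 : b - a - c.2 < 0 := by
    by_contra! h
    nlinarith
  have := hcon c hc (by nlinarith)
  nlinarith

/-- The point `(1 - t) x + t y` of the cube; `t` is truncated to `[0,1]`. -/
def cubeSegment {J : Type u} (x y : J → unitInterval) (t : ℝ) : J → unitInterval := fun j =>
  ⟨(1 - unitTrunc t) * x j + unitTrunc t * y j, by
    have h0 : 0 ≤ unitTrunc t := le_max_left _ _
    have h1 : unitTrunc t ≤ 1 := max_le zero_le_one (min_le_right _ _)
    exact (convex_Icc (0 : ℝ) 1) (x j).2 (y j).2 (by linarith) h0 (by ring)⟩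

theorem continuous_cubeSegment {J : Type u} (x y : J → unitInterval) :
    Continuous (cubeSegment x y) := by
  refine continuous_pi fun j => Continuous.subtype_mk ?_ _
  unfold unitTrunc
  fun_prop

/-- Along the segment from `x` to `y` every affine piece becomes affine in one variable, so
`exists_affine_le_ge` applies. -/
theorem IsIntPiecewiseLinear.exists_le_ge {J : Type u} [Fintype J]
    {f : (J → unitInterval) → unitInterval} (hf : Continuous f) {F : Finset ((J → ℤ) × ℤ)}
    (hF : ∀ x, ∃ c ∈ F, (f x : ℝ) = intAffine c x) (x y : J → unitInterval) :
    ∃ c ∈ F, intAffine c x ≤ f x ∧ (f y : ℝ) ≤ intAffine c y := by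
  classical
  obtain ⟨d, hd, h0, h1⟩ := exists_affine_le_ge (φ := fun t => (f (cubeSegment x y t) : ℝ))
    (continuous_subtype_val.comp (hf.comp (continuous_cubeSegment x y)))
    (F.image fun c => (intAffine c x, intAffine c y - intAffine c x)) (fun t ht0 ht1 => by
      obtain ⟨c, hc, h⟩ := hF (cubeSegment x y t)
      refine ⟨_, Finset.mem_image_of_mem _ hc, ?_⟩
      rw [h]
      simp only [intAffine, cubeSegment, unitTrunc_of_mem ht0 ht1]
      have : ∑ j, (c.1 j : ℝ) * ((1 - t) * x j + t * y j) =
          (1 - t) * ∑ j, (c.1 j : ℝ) * x j + t * ∑ j, (c.1 j : ℝ) * y j := by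
        rw [Finset.mul_sum, Finset.mul_sum, ← Finset.sum_add_distrib]
        exact Finset.sum_congr rfl fun j _ => by ring
      rw [this]
      ring)
  obtain ⟨c, hc, rfl⟩ := Finset.mem_image.1 hd
  have e0 : cubeSegment x y 0 = x := by
    ext j
    simp [cubeSegment, unitTrunc_of_nonpos]
  have e1 : cubeSegment x y 1 = y := by
    ext j
    simp [cubeSegment, unitTrunc_of_one_le]
  simp only [e0, e1] at h0 h1
  exact ⟨c, hc, h0, by linarith⟩

/-- McNaughton's theorem: continuous piecewise linear functions with integer coefficients are
defined by MV-terms. -/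
theorem IsIntPiecewiseLinear.exists_term {J : Type u} [Fintype J]
    {f : (J → unitInterval) → unitInterval} (hf : IsIntPiecewiseLinear f) :
    ∃ t : MVTerm J, ∀ x, f x = t.eval x := by
  classical
  obtain ⟨hc, F, hF⟩ := hf
  change ∀ x, ∃ c ∈ F, (f x : ℝ) = intAffine c x at hF
  -- The formula is `f = max_y min_{c ∈ S y} unitTrunc c`, a finite maximum since `S y` is a subset
  -- of `F`. The term for `y = x` is at least `f x`; each other term is at most `f x` because
  -- `exists_le_ge` finds in `S y` a piece lying below `f` at `x`.
  let S : (J → unitInterval) → Finset ((J → ℤ) × ℤ) := fun y =>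
    F.filter fun c => (f y : ℝ) ≤ intAffine c y
  have hS : ∀ y, (S y).Nonempty := fun y => by
    obtain ⟨c, hc, h⟩ := hF y
    exact ⟨c, Finset.mem_filter.2 ⟨hc, h.le⟩⟩
  have hfin : (Set.range S).Finite :=
    (F.powerset.finite_toSet).subset (by
      rintro _ ⟨y, rfl⟩
      exact Finset.mem_coe.2 (Finset.mem_powerset.2 (Finset.filter_subset _ _)))
  let p : (J → ℤ) × ℤ → (J → unitInterval) → ℝ := fun c x => unitTrunc (intAffine c x)
  let m : Finset ((J → ℤ) × ℤ) → (J → unitInterval) → ℝ := fun s =>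
    -- The value `0` only makes `m` total: every `S y` is nonempty.
    if h : s.Nonempty then s.inf' h p else 0
  have hne : hfin.toFinset.Nonempty := ⟨S fun _ => 0, by simp⟩
  have hterm : IsTermFun (hfin.toFinset.sup' hne m) := by
    refine Finset.sup'_induction hne m (fun _ ha _ hb => ha.sup hb) fun s hs => ?_
    obtain ⟨y, rfl⟩ := hfin.mem_toFinset.1 hs
    simp only [m, dif_pos (hS y)]
    exact Finset.inf'_induction _ p (fun _ ha _ hb => ha.inf hb) fun c _ =>
      isTermFun_unitTrunc_intAffine c
  have heq : ∀ x, (f x : ℝ) = hfin.toFinset.sup' hne m x := by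
    intro x
    have hx : unitTrunc (f x) = f x := unitTrunc_of_mem (f x).2.1 (f x).2.2
    rw [Finset.sup'_apply]
    apply le_antisymm
    · refine le_trans ?_ (Finset.le_sup' (fun s => m s x) (hfin.mem_toFinset.2 ⟨x, rfl⟩))
      simp only [m, dif_pos (hS x), Finset.inf'_apply]
      refine Finset.le_inf' _ _ fun c hc => ?_
      rw [← hx]
      exact unitTrunc_mono (Finset.mem_filter.1 hc).2
    · refine Finset.sup'_le _ _ fun s hs => ?_
      obtain ⟨y, rfl⟩ := hfin.mem_toFinset.1 hs
      simp only [m, dif_pos (hS y), Finset.inf'_apply]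
      obtain ⟨c, hc, h1, h2⟩ := exists_le_ge hc hF x y
      refine (Finset.inf'_le _ (Finset.mem_filter.2 ⟨hc, h2⟩)).trans ?_
      rw [← hx]
      exact unitTrunc_mono h1
  obtain ⟨t, ht⟩ := hterm
  exact ⟨t, fun x => Subtype.ext ((heq x).trans (ht x))⟩

/-- `ℤ`-maps are restrictions of term functions. -/
theorem IsZMap.exists_term {I : Type u} {X : Set (I → unitInterval)} {g : X → unitInterval}
    (hg : IsZMap X g) : ∃ t : MVTerm I, ∀ p : X, g p = t.eval p.1 := by
  obtain ⟨ξ, ⟨I', f, hf, h⟩, hξ⟩ := hg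
  obtain ⟨t, ht⟩ := hf.exists_term
  exact ⟨t.rename (↑), fun p => by rw [hξ, h, ht, MVTerm.eval_rename]⟩

/-! ### Separation of points by terms -/

/-- With `m = ⌊n x_j⌋`, the bump is the minimum of the truncations of `n y_j - m + 1` and `m + 2 - n
y_j`. Both affine functions are at least `1` at `x`, and `n ε > 3` makes one of them negative as
soon as `y_j` is `ε` away from `x_j`. -/
theorem exists_isTermFun_coord_bump {J : Type u} [Fintype J] (x : J → unitInterval) (j : J)
    {ε : ℝ} (hε : 0 < ε) : ∃ f : (J → unitInterval) → ℝ, IsTermFun f ∧ f x = 1 ∧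
      ∀ y, ε ≤ |(y j : ℝ) - x j| → f y = 0 := by
  classical
  obtain ⟨n, hn⟩ := exists_nat_gt (3 / ε)
  rw [div_lt_iff₀ hε] at hn
  have hn0 : (0 : ℝ) ≤ n := Nat.cast_nonneg n
  set m := ⌊(n : ℝ) * x j⌋
  have hm := Int.floor_le ((n : ℝ) * x j)
  have hm' := Int.lt_floor_add_one ((n : ℝ) * x j)
  have e1 : ∀ y, intAffine (Pi.single j (n : ℤ), 1 - m) y = n * y j - m + 1 := fun y => by
    rw [intAffine, Finset.sum_eq_single j]
    · simp; ring
    · intro i _ hi; simp [hi]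
    · simp
  have e2 : ∀ y, intAffine (Pi.single j (-n : ℤ), m + 2) y = m + 2 - n * y j := fun y => by
    rw [intAffine, Finset.sum_eq_single j]
    · simp; ring
    · intro i _ hi; simp [hi]
    · simp
  have h1 := isTermFun_unitTrunc_intAffine (Pi.single j (n : ℤ), 1 - m)
  have h2 := isTermFun_unitTrunc_intAffine (Pi.single j (-n : ℤ), m + 2)
  refine ⟨_, h1.inf h2, ?_, fun y hy => ?_⟩
  · simp only [Pi.inf_apply, e1, e2]
    rw [unitTrunc_of_one_le (by linarith), unitTrunc_of_one_le (by linarith), inf_idem]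
  · refine le_antisymm ?_ ((h1.inf h2).nonneg y)
    simp only [Pi.inf_apply, e1, e2]
    rcases le_abs'.1 hy with h | h
    · refine inf_le_left.trans (unitTrunc_of_nonpos ?_).le
      nlinarith
    · refine inf_le_right.trans (unitTrunc_of_nonpos ?_).le
      nlinarith

theorem exists_isTermFun_bump {J : Type u} [Fintype J] (x : J → unitInterval) {ε : ℝ}
    (hε : 0 < ε) (s : Finset J) : ∃ f : (J → unitInterval) → ℝ, IsTermFun f ∧ f x = 1 ∧
      ∀ y, (∃ j ∈ s, ε ≤ |(y j : ℝ) - x j|) → f y = 0 := by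
  classical
  induction s using Finset.induction_on with
  | empty => exact ⟨_, IsTermFun.const_one, rfl, by simp⟩
  | insert j s _ ih =>
    obtain ⟨f, hf, hfx, hfy⟩ := ih
    obtain ⟨g, hg, hgx, hgy⟩ := exists_isTermFun_coord_bump x j hε
    refine ⟨_, hf.inf hg, by simp [hfx, hgx], fun y hy => le_antisymm ?_ ((hf.inf hg).nonneg y)⟩
    obtain ⟨i, hi, h⟩ := hy
    rcases Finset.mem_insert.1 hi with rfl | hi
    · exact inf_le_right.trans (hgy y h).le
    · exact inf_le_left.trans (hfy y ⟨i, hi, h⟩).le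

/-- Terms separate points from closed sets. -/
theorem exists_term_separating {J : Type u} [Fintype J] {K : Set (J → unitInterval)}
    (hK : IsClosed K) {x : J → unitInterval} (hx : x ∉ K) :
    ∃ t : MVTerm J, (∀ y ∈ K, t.eval y = MVAlgebra.zero) ∧ t.eval x ≠ MVAlgebra.zero := by
  obtain ⟨ε, hε, hball⟩ := Metric.isOpen_iff.1 hK.isOpen_compl x hx
  obtain ⟨f, ⟨t, ht⟩, hfx, hfy⟩ := exists_isTermFun_bump x hε Finset.univ
  refine ⟨t, fun y hy => Subtype.ext ?_, fun h => ?_⟩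
  · rw [← ht]
    refine hfy y ?_
    by_contra! h
    exact hball (Metric.mem_ball.2 ((dist_pi_lt_iff hε).2 fun j => h j (Finset.mem_univ j))) hy
  · have := ht x
    rw [hfx, h] at this
    exact one_ne_zero this

/-! ### Homomorphisms into `[0,1]` -/

namespace MVAlgebra

theorem isHom_val {A : Type u} [MVAlgebra A] (B : Subalgebra A) :
    IsHom (Subtype.val : B.carrier → A) :=
  ⟨rfl, fun _ _ => rfl, fun _ => rfl⟩

theorem IsHom.comp {A : Type u} {B : Type v} {C : Type w} [MVAlgebra A] [MVAlgebra B]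
    [MVAlgebra C] {g : B → C} {f : A → B} (hg : IsHom g) (hf : IsHom f) :
    IsHom fun a => g (f a) where
  map_zero := by rw [hf.map_zero, hg.map_zero]
  map_oplus a b := by rw [hf.map_oplus, hg.map_oplus]
  map_neg a := by rw [hf.map_neg, hg.map_neg]

/-- If a compact set `X` of homomorphisms `A → [0,1]` separates the points of `A`, then on a finite
set every homomorphism from a subalgebra of `A` to `[0,1]` agrees with a member of `X`. -/
theorem exists_mem_eq_of_isHom {A : Type u} [MVAlgebra A] {X : Set (A → unitInterval)}
    (hXc : IsCompact X) (hX : X ⊆ dualSpace A)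
    (hsep : ∀ a b, (∀ p ∈ X, p a = p b) → a = b) {B : Type v} [MVAlgebra B] {i : B → A}
    (hi : IsHom i) (hinj : Function.Injective i) {h : B → unitInterval} (hh : IsHom h)
    {Z : Type w} [Finite Z] (z : Z → B) : ∃ p ∈ X, ∀ k, p (i (z k)) = h (z k) := by
  by_contra! hcon
  have := Fintype.ofFinite Z
  let r : (A → unitInterval) → (Z → unitInterval) := fun p k => p (i (z k))
  have hr : Continuous r := continuous_pi fun k => continuous_apply _
  have hx : (fun k => h (z k)) ∉ r '' X := by
    rintro ⟨p, hp, hpz⟩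
    obtain ⟨k, hne⟩ := hcon p hp
    exact hne (congrFun hpz k)
  -- The term vanishes at the tuple under every member of `X`, hence already in `A` by separation,
  -- hence in `B` by injectivity; then `h` must kill it too.
  obtain ⟨t, ht0, ht1⟩ := exists_term_separating (hXc.image hr).isClosed hx
  have hz : t.eval (fun k => i (z k)) = (zero : A) := by
    refine hsep _ _ fun p hp => ?_
    rw [(hX hp).map_eval, (hX hp).map_zero]
    exact ht0 _ ⟨p, hp, rfl⟩
  have hz' : t.eval z = (zero : B) := hinj (by rw [hi.map_eval, hz, hi.map_zero])
  apply ht1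
  rw [← hh.map_eval, hz', hh.map_zero]

/-- One inclusion is `exists_mem_eq_of_isHom`, the other is restriction along `i`. It is used with
`i` the identity and `X` a space of evaluations, and with `i` a subalgebra inclusion and `X` the
full dual space. -/
theorem image_dualSpace_eq {A : Type u} [MVAlgebra A] {X : Set (A → unitInterval)}
    (hXc : IsCompact X) (hX : X ⊆ dualSpace A)
    (hsep : ∀ a b, (∀ p ∈ X, p a = p b) → a = b) {B : Type v} [MVAlgebra B] {i : B → A}
    (hi : IsHom i) (hinj : Function.Injective i) {Z : Type w} [Finite Z] (z : Z → B) :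
    (fun (q : B → unitInterval) k => (q (z k) : ℝ)) '' dualSpace B =
      (fun (p : A → unitInterval) k => (p (i (z k)) : ℝ)) '' X := by
  ext y
  constructor
  · rintro ⟨h, hh, rfl⟩
    obtain ⟨p, hp, hpz⟩ := exists_mem_eq_of_isHom hXc hX hsep hi hinj hh z
    exact ⟨p, hp, funext fun k => congrArg Subtype.val (hpz k)⟩
  · rintro ⟨p, hp, rfl⟩
    exact ⟨fun b => p (i b), (hX hp).comp hi, rfl⟩

end MVAlgebra

/-! ### Polytopes and half-spaces -/

/-- Coupling `v ∈ N` with `w ∈ P` by weight `l v * l w / G` moves all the mass on `P`, and a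
proportion of that on `N`, to the points where `g` vanishes. The map `a` is arbitrary so that one
identity gives both the barycentre (`a` the identity) and the total weight (`a = 1`). -/
theorem sum_smul_crossing {E : Type u} {M : Type v} [AddCommGroup M] [Module ℝ M] (N P : Finset E)
    (l g : E → ℝ) (a : E → M) {G : ℝ} (hG : G = ∑ v ∈ N, l v * -g v)
    (hP : G = 0 → ∀ w ∈ P, l w = 0) :
    ∑ q ∈ N ×ˢ P, (l q.1 * l q.2 / G) • (g q.2 • a q.1 - g q.1 • a q.2) =
      ((∑ w ∈ P, l w * g w) / G) • ∑ v ∈ N, l v • a v + ∑ w ∈ P, l w • a w := by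
  rcases eq_or_ne G 0 with h0 | h0
  · rw [h0]
    simp only [div_zero, zero_smul, Finset.sum_const_zero, zero_add]
    exact (Finset.sum_eq_zero fun w hw => by rw [hP h0 w hw, zero_smul]).symm
  · have e1 : ((∑ w ∈ P, l w * g w) / G) • ∑ v ∈ N, l v • a v =
        ∑ q ∈ N ×ˢ P, (l q.1 * l q.2 / G * g q.2) • a q.1 := by
      rw [Finset.sum_product, Finset.smul_sum]
      refine Finset.sum_congr rfl fun v _ => ?_
      dsimp only
      rw [← Finset.sum_smul, smul_smul, Finset.sum_div, Finset.sum_mul]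
      congr 1
      exact Finset.sum_congr rfl fun w _ => by ring
    have e2 : ∑ w ∈ P, l w • a w = ∑ q ∈ N ×ˢ P, (l q.1 * l q.2 / G * -g q.1) • a q.2 := by
      rw [Finset.sum_product_right]
      refine Finset.sum_congr rfl fun w _ => ?_
      dsimp only
      rw [← Finset.sum_smul]
      congr 1
      calc l w = l w * (G / G) := by rw [div_self h0, mul_one]
        _ = _ := by
          nth_rewrite 1 [hG]
          rw [Finset.sum_div, Finset.mul_sum]
          exact Finset.sum_congr rfl fun v _ => by ring
    rw [e1, e2, ← Finset.sum_add_distrib]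
    refine Finset.sum_congr rfl fun q _ => ?_
    rw [smul_sub, smul_smul, smul_smul, mul_neg, neg_smul, sub_eq_add_neg]

section Polytopes

variable {E : Type u} [AddCommGroup E] [Module ℝ E]

theorem AffineMap.map_sum_smul_of_sum_eq_one (g : E →ᵃ[ℝ] ℝ) (s : Finset E) {l : E → ℝ}
    (hl : ∑ y ∈ s, l y = 1) : g (∑ y ∈ s, l y • y) = ∑ y ∈ s, l y * g y := by
  have h : ∀ x, g x = g.linear x + g 0 := fun x => congrFun g.decomp x
  have h' : ∀ y ∈ s, l y * g y = g.linear (l y • y) + l y * g 0 := fun y _ => by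
    rw [h y, mul_add, map_smul, smul_eq_mul]
  rw [Finset.sum_congr rfl h', Finset.sum_add_distrib, ← Finset.sum_mul, hl, one_mul, ← map_sum, h]

/-- The intersection of a polytope and a half-space is a polytope. -/
theorem exists_convexHull_eq_inter_halfspace (V : Finset E) (g : E →ᵃ[ℝ] ℝ) :
    ∃ W : Finset E, convexHull ℝ (W : Set E) = convexHull ℝ (V : Set E) ∩ {x | g x ≤ 0} := by
  classical
  set N := V.filter fun v => g v ≤ 0 with hN
  set P := V.filter fun v => ¬ g v ≤ 0 with hP
  have hlt : ∀ v ∈ N, ∀ w ∈ P, 0 < g w - g v := fun v hv w hw => by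
    have h1 := (Finset.mem_filter.1 hv).2
    have h2 := not_le.1 (Finset.mem_filter.1 hw).2
    linarith
  -- The zero of `g` on the segment joining `q.1` to `q.2`.
  let c : E × E → E := fun q =>
    (g q.2 / (g q.2 - g q.1)) • q.1 + (-g q.1 / (g q.2 - g q.1)) • q.2
  have hconv : Convex ℝ {x | g x ≤ 0} := (convex_Iic (0 : ℝ)).affine_preimage g
  refine ⟨N ∪ (N ×ˢ P).image c, Set.Subset.antisymm ?_ ?_⟩
  · refine convexHull_min ?_ ((convex_convexHull ℝ _).inter hconv)
    intro x hx
    rcases Finset.mem_union.1 (Finset.mem_coe.1 hx) with hx | hx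
    · exact ⟨subset_convexHull ℝ _ (Finset.mem_coe.2 (Finset.mem_filter.1 hx).1),
        (Finset.mem_filter.1 hx).2⟩
    · obtain ⟨⟨v, w⟩, hq, rfl⟩ := Finset.mem_image.1 hx
      obtain ⟨hv, hw⟩ := Finset.mem_product.1 hq
      dsimp only at hv hw
      have hd := hlt v hv w hw
      have hv' := (Finset.mem_filter.1 hv).2
      have hw' := not_le.1 (Finset.mem_filter.1 hw).2
      have hsum : g w / (g w - g v) + -g v / (g w - g v) = 1 := by
        rw [← add_div, ← sub_eq_add_neg, div_self hd.ne']
      refine ⟨convex_convexHull ℝ _ (subset_convexHull ℝ _ (Finset.mem_coe.2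
        (Finset.mem_filter.1 hv).1)) (subset_convexHull ℝ _ (Finset.mem_coe.2
        (Finset.mem_filter.1 hw).1)) (div_nonneg hw'.le hd.le) (div_nonneg (by linarith) hd.le)
        hsum, ?_⟩
      change g _ ≤ 0
      rw [Convex.combo_affine_apply hsum]
      refine le_of_eq ?_
      simp only [smul_eq_mul]
      ring
  · rintro x ⟨hx, hgx⟩
    change g x ≤ 0 at hgx
    obtain ⟨l, hl0, hl1, rfl⟩ := Finset.mem_convexHull'.1 hx
    rw [g.map_sum_smul_of_sum_eq_one V hl1] at hgx
    have hl0N : ∀ v ∈ N, 0 ≤ l v := fun v hv => hl0 v (Finset.mem_filter.1 hv).1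
    have hl0P : ∀ v ∈ P, 0 ≤ l v := fun v hv => hl0 v (Finset.mem_filter.1 hv).1
    set G := ∑ v ∈ N, l v * -g v with hG
    set H := ∑ w ∈ P, l w * g w with hH
    have hG0 : 0 ≤ G := Finset.sum_nonneg fun v hv =>
      mul_nonneg (hl0N v hv) (neg_nonneg.2 (Finset.mem_filter.1 hv).2)
    have hterm : ∀ w ∈ P, 0 ≤ l w * g w := fun w hw =>
      mul_nonneg (hl0P w hw) (not_le.1 (Finset.mem_filter.1 hw).2).le
    have hH0 : 0 ≤ H := Finset.sum_nonneg hterm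
    have hHG : H ≤ G := by
      rw [← Finset.sum_filter_add_sum_filter_not V (fun v => g v ≤ 0)] at hgx
      have : G = -∑ v ∈ N, l v * g v := by
        rw [hG, ← Finset.sum_neg_distrib]
        exact Finset.sum_congr rfl fun _ _ => by ring
      linarith
    have hGP : G = 0 → ∀ w ∈ P, l w = 0 := fun h w hw => by
      have h1 : H = 0 := le_antisymm (hHG.trans h.le) hH0
      have h2 := (Finset.sum_eq_zero_iff_of_nonneg hterm).1 h1 w hw
      exact (mul_eq_zero.1 h2).resolve_right (not_le.1 (Finset.mem_filter.1 hw).2).ne'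
    have hr1 : H / G ≤ 1 := div_le_one_of_le₀ hHG hG0
    -- The point is rewritten with weight `(1 - H / G) * l v` left on `v ∈ N` and the rest on
    -- crossing points. Nonnegativity is `H ≤ G`, that is, `g ≤ 0` at the point; if `G = 0` there is
    -- no mass on `P`, and `H / G = 0` leaves `N` untouched.
    have key := (convex_convexHull ℝ ((N ∪ (N ×ˢ P).image c : Finset E) : Set E)).sum_mem
      (t := N.disjSum (N ×ˢ P))
      (w := Sum.elim (fun v => (1 - H / G) * l v)
        fun q => l q.1 * l q.2 / G * (g q.2 - g q.1))
      (z := Sum.elim id c) ?_ ?_ ?_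
    · rw [Finset.sum_disjSum] at key
      convert key using 1
      rw [← Finset.sum_filter_add_sum_filter_not V (fun v => g v ≤ 0)]
      simp only [Sum.elim_inl, Sum.elim_inr, id]
      have e : ∑ q ∈ N ×ˢ P, (l q.1 * l q.2 / G * (g q.2 - g q.1)) • c q =
          ∑ q ∈ N ×ˢ P, (l q.1 * l q.2 / G) • (g q.2 • q.1 - g q.1 • q.2) := by
        refine Finset.sum_congr rfl fun q hq => ?_
        obtain ⟨hv, hw⟩ := Finset.mem_product.1 hq
        have hd := (hlt _ hv _ hw).ne'
        rw [mul_smul]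
        congr 1
        simp only [c, smul_add, smul_smul]
        rw [mul_div_cancel₀ _ hd, mul_div_cancel₀ _ hd, neg_smul, sub_eq_add_neg]
      rw [e, sum_smul_crossing N P l g (fun x => x) hG hGP, ← hH]
      simp only [mul_smul, ← Finset.smul_sum]
      rw [← add_assoc, ← add_smul, sub_add_cancel, one_smul]
    · rintro (v | q) hi
      · exact mul_nonneg (by linarith) (hl0N v (Finset.inl_mem_disjSum.1 hi))
      · obtain ⟨hv, hw⟩ := Finset.mem_product.1 (Finset.inr_mem_disjSum.1 hi)
        exact mul_nonneg (div_nonneg (mul_nonneg (hl0N _ hv) (hl0P _ hw)) hG0)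
          (hlt _ hv _ hw).le
    · rw [Finset.sum_disjSum]
      simp only [Sum.elim_inl, Sum.elim_inr]
      have e := sum_smul_crossing N P l g (fun _ => (1 : ℝ)) hG hGP
      simp only [smul_eq_mul, mul_one] at e
      rw [e, ← hH, ← Finset.mul_sum, ← add_assoc, ← add_mul, sub_add_cancel, one_mul,
        Finset.sum_filter_add_sum_filter_not V (fun v => g v ≤ 0), hl1]
    · rintro (v | q) hi
      · exact subset_convexHull ℝ _ (Finset.mem_coe.2 (Finset.mem_union_left _
          (Finset.inl_mem_disjSum.1 hi)))
      · exact subset_convexHull ℝ _ (Finset.mem_coe.2 (Finset.mem_union_right _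
          (Finset.mem_image_of_mem c (Finset.inr_mem_disjSum.1 hi))))

/-! ### Subdividing polytopes until term functions become affine -/

/-- Every polytope `convexHull V` is a finite union of polytopes with property `Q`. -/
def IsRefinable (Q : Finset E → Prop) (V : Finset E) : Prop :=
  ∃ T : Finset (Finset E), convexHull ℝ (V : Set E) = ⋃ W ∈ T, convexHull ℝ (W : Set E) ∧
    ∀ W ∈ T, Q W

theorem IsRefinable.of_self {Q : Finset E → Prop} {V : Finset E} (h : Q V) : IsRefinable Q V :=
  ⟨{V}, by simp, by simpa using h⟩

theorem IsRefinable.bind {Q R : Finset E → Prop} {V : Finset E} (h : IsRefinable Q V)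
    (hQR : ∀ W : Finset E, convexHull ℝ (W : Set E) ⊆ convexHull ℝ (V : Set E) → Q W →
      IsRefinable R W) : IsRefinable R V := by
  classical
  obtain ⟨T, hT, hQ⟩ := h
  have hsub : ∀ W ∈ T, convexHull ℝ (W : Set E) ⊆ convexHull ℝ (V : Set E) := fun W hW => by
    rw [hT]
    exact Set.subset_biUnion_of_mem (u := fun W : Finset E => convexHull ℝ (W : Set E)) hW
  choose! S hS hR using fun W hW => hQR W (hsub W hW) (hQ W hW)
  refine ⟨T.biUnion S, ?_, fun U hU => ?_⟩
  · rw [hT, Finset.set_biUnion_biUnion]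
    exact Set.iUnion₂_congr hS
  · obtain ⟨W, hW, hU⟩ := Finset.mem_biUnion.1 hU
    exact hR W hW U hU

theorem isRefinable_sign (g : E →ᵃ[ℝ] ℝ) (V : Finset E) :
    IsRefinable (fun W => (∀ x ∈ convexHull ℝ (W : Set E), g x ≤ 0) ∨
      ∀ x ∈ convexHull ℝ (W : Set E), 0 ≤ g x) V := by
  classical
  obtain ⟨W₁, h₁⟩ := exists_convexHull_eq_inter_halfspace V g
  obtain ⟨W₂, h₂⟩ := exists_convexHull_eq_inter_halfspace V (-g)
  refine ⟨{W₁, W₂}, ?_, ?_⟩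
  · rw [Finset.set_biUnion_insert, Finset.set_biUnion_singleton, h₁, h₂, ← Set.inter_union_distrib_left,
      Set.inter_eq_left.2]
    intro x _
    rcases le_total (g x) 0 with h | h
    · exact Or.inl h
    · exact Or.inr (by simpa using h)
  · intro W hW
    rcases Finset.mem_insert.1 hW with rfl | hW
    · exact Or.inl fun x hx => (h₁ ▸ hx).2
    · rw [Finset.mem_singleton.1 hW]
      rw [h₂]
      exact Or.inr fun x hx => neg_nonpos.1 hx.2

/-- `f` is affine on the polytope spanned by `W`. -/
def IsAffineOnHull {F : Type v} [AddCommGroup F] [Module ℝ F] (f : E → F) (W : Finset E) : Prop :=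
  ∃ g : E →ᵃ[ℝ] F, ∀ x ∈ convexHull ℝ (W : Set E), f x = g x

end Polytopes

/-- Only a truncated sum creates a new break: once both summands are affine, cutting along the
hyperplane where they sum to `1` makes the minimum affine on each side. -/
theorem isRefinable_realEval {J : Type u} (t : MVTerm J) (V : Finset (J → ℝ)) :
    IsRefinable (IsAffineOnHull fun x => t.realEval x) V := by
  induction t generalizing V with
  | var j => exact .of_self ⟨(LinearMap.proj j : (J → ℝ) →ₗ[ℝ] ℝ).toAffineMap, fun x _ => rfl⟩
  | zero => exact .of_self ⟨0, fun x _ => rfl⟩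
  | neg t ih =>
    refine (ih V).bind fun W _ ⟨g, hg⟩ => .of_self ⟨AffineMap.const ℝ _ 1 - g, fun x hx => ?_⟩
    simp [MVTerm.realEval, hg x hx]
  | oplus s t hs ht =>
    refine (hs V).bind fun W _ ⟨g, hg⟩ => (ht W).bind fun W' hW' ⟨g', hg'⟩ =>
      (isRefinable_sign (g + g' - AffineMap.const ℝ _ 1) W').bind fun U hU h => .of_self ?_
    rcases h with h | h
    · refine ⟨g + g', fun x hx => ?_⟩
      have := h x hx
      simp only [MVTerm.realEval, hg x (hW' (hU hx)), hg' x (hU hx)]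
      exact min_eq_left (by simpa using this)
    · refine ⟨AffineMap.const ℝ _ 1, fun x hx => ?_⟩
      have := h x hx
      simp only [MVTerm.realEval, hg x (hW' (hU hx)), hg' x (hU hx)]
      exact min_eq_right (by simpa using this)

theorem isRefinable_realEval_pi {J : Type u} {Z : Type v} [Finite Z] (t : Z → MVTerm J)
    (V : Finset (J → ℝ)) :
    IsRefinable (IsAffineOnHull fun x z => (t z).realEval x) V := by
  classical
  have := Fintype.ofFinite Z
  have key : ∀ s : Finset Z,
      IsRefinable (fun W => ∀ z ∈ s, IsAffineOnHull (fun x => (t z).realEval x) W) V := by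
    intro s
    induction s using Finset.induction_on with
    | empty => exact .of_self (by simp)
    | insert z s _ ih =>
      refine ih.bind fun W _ hW => (isRefinable_realEval (t z) W).bind fun U hU h => .of_self ?_
      intro z' hz'
      rcases Finset.mem_insert.1 hz' with rfl | hz'
      · exact h
      · obtain ⟨g, hg⟩ := hW z' hz'
        exact ⟨g, fun x hx => hg x (hU hx)⟩
  refine (key Finset.univ).bind fun W _ hW => .of_self ?_
  choose g hg using fun z => hW z (Finset.mem_univ z)
  exact ⟨AffineMap.pi g, fun x hx => funext fun z => hg z x hx⟩

/-! ### Polyhedra -/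

/-- Polyhedra are the finite unions of polytopes. -/
theorem isPolyhedron_iff {ι : Type u} [Finite ι] {P : Set (ι → ℝ)} :
    IsPolyhedron P ↔ ∃ T : Finset (Finset (ι → ℝ)), P = ⋃ W ∈ T, convexHull ℝ (W : Set (ι → ℝ)) := by
  classical
  constructor
  · rintro ⟨T, hT, hS, rfl⟩
    choose! V _ _ hV using hS
    refine ⟨hT.toFinset.image V, ?_⟩
    rw [Finset.set_biUnion_finset_image, Set.sUnion_eq_biUnion]
    simp only [Set.Finite.mem_toFinset]
    exact Set.iUnion₂_congr hV
  · rintro ⟨T, rfl⟩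
    refine ⟨{S | ∃ W ∈ T, ∃ V ⊆ W, V.Nonempty ∧ AffineIndependent ℝ ((↑) : V → ι → ℝ) ∧
      S = convexHull ℝ (V : Set (ι → ℝ))}, ?_, ?_, ?_⟩
    · refine ((T.biUnion Finset.powerset).image fun V : Finset (ι → ℝ) =>
        convexHull ℝ (V : Set (ι → ℝ))).finite_toSet.subset ?_
      rintro _ ⟨W, hW, V, hVW, -, -, rfl⟩
      exact Finset.mem_coe.2 (Finset.mem_image_of_mem _
        (Finset.mem_biUnion.2 ⟨W, hW, Finset.mem_powerset.2 hVW⟩))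
    · rintro _ ⟨W, hW, V, hVW, hne, hV, rfl⟩
      exact ⟨V, hne, hV, rfl⟩
    · ext x
      simp only [Set.mem_iUnion, Set.mem_sUnion]
      constructor
      · rintro ⟨W, hW, hx⟩
        -- Carathéodory: each point of a polytope lies in a simplex spanned by some of the given
        -- points.
        rw [convexHull_eq_union] at hx
        simp only [Set.mem_iUnion] at hx
        obtain ⟨V, hVW, hV, hx⟩ := hx
        refine ⟨_, ⟨W, hW, V, Finset.coe_subset.1 hVW, ?_, hV, rfl⟩, hx⟩
        exact Finset.coe_nonempty.1 (convexHull_nonempty_iff.1 ⟨x, hx⟩)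
      · rintro ⟨_, ⟨W, hW, V, hVW, -, -, rfl⟩, hx⟩
        exact ⟨W, hW, convexHull_mono (Finset.coe_subset.2 hVW) hx⟩

/-- After subdivision the map is affine on each polytope, and an affine map sends a convex hull to
the hull of the images. -/
theorem IsPolyhedron.image_realEval {J : Type u} {Z : Type v} [Finite J] [Finite Z]
    {P : Set (J → ℝ)} (hP : IsPolyhedron P) (t : Z → MVTerm J) :
    IsPolyhedron ((fun x z => (t z).realEval x) '' P) := by
  classical
  obtain ⟨T, rfl⟩ := isPolyhedron_iff.1 hP
  choose S hS hA using fun W => isRefinable_realEval_pi t W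
  choose! g hg using hA
  refine isPolyhedron_iff.2 ⟨T.biUnion fun W => (S W).image fun U => U.image (g W U), ?_⟩
  simp only [Finset.set_biUnion_biUnion, Finset.set_biUnion_finset_image, Set.image_iUnion]
  refine Set.iUnion₂_congr fun W _ => ?_
  rw [hS W]
  simp only [Set.image_iUnion]
  refine Set.iUnion₂_congr fun U hU => ?_
  rw [Finset.coe_image, ← AffineMap.image_convexHull]
  exact Set.image_congr (hg W U hU)

/-- The image of an infinite dimensional polyhedron under finitely many terms is a polyhedron. -/
theorem IsInfinitePolyhedron.isPolyhedron_image_eval {Y : Type u} {Z : Type v} [Finite Z]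
    {X : Set (Y → unitInterval)} (hX : IsInfinitePolyhedron X) (t : Z → MVTerm Y) :
    IsPolyhedron ((fun p z => ((t z).eval p : unitInterval).1) '' X) := by
  classical
  have := Fintype.ofFinite Z
  -- Finitely many terms involve finitely many variables, so the map factors through a single finite
  -- projection of `X`.
  choose s hs using fun z => (t z).exists_finset
  choose t' ht' using fun z => hs z (Finset.univ.biUnion s)
    (Finset.subset_biUnion_of_mem s (Finset.mem_univ z))
  convert (hX (Finset.univ.biUnion s)).image_realEval t' using 1
  rw [Set.image_image]
  refine Set.image_congr fun p _ => funext fun z => ?_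
  rw [ht' z, MVTerm.eval_rename, MVTerm.coe_eval]
  rfl

/-! ### Elementary theory of MV-algebras -/

namespace MVAlgebra

local infixl:65 " ⊕ᴹ " => MVAlgebra.oplus
local prefix:max "∼" => MVAlgebra.neg
local notation "𝟘" => MVAlgebra.zero

section Basic

variable {A : Type u} [MVAlgebra A]

/-- Truncated subtraction. -/
def tsub (x y : A) : A := ∼(∼x ⊕ᴹ y)

/-- The order of an MV-algebra. -/
def Le (x y : A) : Prop := tsub x y = 𝟘

theorem neg_inj {x y : A} (h : ∼x = ∼y) : x = y := by
  rw [← neg_neg x, h, neg_neg]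

theorem zero_oplus (x : A) : 𝟘 ⊕ᴹ x = x := by rw [oplus_comm, oplus_zero]

theorem neg_zero_oplus (x : A) : ∼𝟘 ⊕ᴹ x = ∼𝟘 := by rw [oplus_comm, oplus_neg_zero]

theorem oplus_left_comm (x y z : A) : x ⊕ᴹ (y ⊕ᴹ z) = y ⊕ᴹ (x ⊕ᴹ z) := by
  rw [← oplus_assoc, oplus_comm x, oplus_assoc]

theorem oplus_right_comm (x y z : A) : x ⊕ᴹ y ⊕ᴹ z = x ⊕ᴹ z ⊕ᴹ y := by
  rw [oplus_assoc, oplus_comm y, oplus_assoc]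

theorem oplus_neg_self (x : A) : x ⊕ᴹ ∼x = ∼𝟘 := by
  have := lukasiewicz x (∼𝟘)
  rwa [neg_neg, oplus_zero, neg_zero_oplus] at this

theorem neg_oplus_self (x : A) : ∼x ⊕ᴹ x = ∼𝟘 := by rw [oplus_comm, oplus_neg_self]

theorem neg_tsub (x y : A) : ∼(tsub x y) = ∼x ⊕ᴹ y := neg_neg _

/-- The Łukasiewicz axiom in disguise: both sides are the join of `x` and `y`. -/
theorem tsub_oplus_comm (x y : A) : tsub x y ⊕ᴹ y = tsub y x ⊕ᴹ x := by
  have := lukasiewicz y x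
  rwa [oplus_comm y, oplus_comm x, oplus_comm y, oplus_comm x] at this

theorem le_iff_neg {x y : A} : Le x y ↔ ∼x ⊕ᴹ y = ∼𝟘 := by
  rw [Le, ← neg_tsub]
  exact ⟨fun h => by rw [h], neg_inj⟩

theorem Le.tsub_oplus {x y : A} (h : Le x y) : tsub y x ⊕ᴹ x = y := by
  rw [← tsub_oplus_comm, h, zero_oplus]

theorem le_iff_exists {x y : A} : Le x y ↔ ∃ z, y = x ⊕ᴹ z := by
  constructor
  · exact fun h => ⟨tsub y x, by rw [oplus_comm, h.tsub_oplus]⟩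
  · rintro ⟨z, rfl⟩
    rw [le_iff_neg, ← oplus_assoc, neg_oplus_self, neg_zero_oplus]

theorem le_oplus_right (x y : A) : Le x (x ⊕ᴹ y) := le_iff_exists.2 ⟨y, rfl⟩

theorem le_oplus_left (x y : A) : Le x (y ⊕ᴹ x) := le_iff_exists.2 ⟨y, oplus_comm _ _⟩

theorem Le.refl (x : A) : Le x x := le_iff_neg.2 (neg_oplus_self x)

theorem Le.trans {x y z : A} (h : Le x y) (h' : Le y z) : Le x z := by
  obtain ⟨a, rfl⟩ := le_iff_exists.1 h
  obtain ⟨b, rfl⟩ := le_iff_exists.1 h'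
  rw [oplus_assoc]
  exact le_oplus_right _ _

theorem Le.antisymm {x y : A} (h : Le x y) (h' : Le y x) : x = y := by
  rw [← h.tsub_oplus, h', zero_oplus]

theorem zero_le (x : A) : Le 𝟘 x := le_iff_exists.2 ⟨x, (zero_oplus x).symm⟩

theorem le_neg_zero (x : A) : Le x (∼𝟘) := le_iff_neg.2 (oplus_neg_zero _)

theorem Le.eq_zero {x : A} (h : Le x 𝟘) : x = 𝟘 := h.antisymm (zero_le x)

theorem Le.eq_neg_zero {x : A} (h : Le (∼𝟘) x) : x = ∼𝟘 := (le_neg_zero x).antisymm h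

theorem Le.oplus_right {x y : A} (h : Le x y) (z : A) : Le (x ⊕ᴹ z) (y ⊕ᴹ z) := by
  obtain ⟨a, rfl⟩ := le_iff_exists.1 h
  rw [oplus_right_comm]
  exact le_oplus_right _ _

theorem Le.oplus_left {x y : A} (h : Le x y) (z : A) : Le (z ⊕ᴹ x) (z ⊕ᴹ y) := by
  rw [oplus_comm z, oplus_comm z]
  exact h.oplus_right z

theorem Le.neg {x y : A} (h : Le x y) : Le (∼y) (∼x) := by
  rw [le_iff_neg, neg_neg, oplus_comm]
  exact le_iff_neg.1 h

theorem le_neg_comm {x y : A} (h : Le x (∼y)) : Le y (∼x) := by simpa [neg_neg] using h.neg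

theorem neg_le_comm {x y : A} (h : Le (∼x) y) : Le (∼y) x := by simpa [neg_neg] using h.neg

theorem neg_le_iff {x y : A} : Le (∼x) y ↔ x ⊕ᴹ y = ∼𝟘 := by rw [le_iff_neg, neg_neg]

theorem tsub_le_iff {t x z : A} : Le (tsub t z) x ↔ Le t (x ⊕ᴹ z) := by
  rw [le_iff_neg, neg_tsub, le_iff_neg, oplus_assoc, oplus_comm z]

theorem tsub_le (x y : A) : Le (tsub x y) x := tsub_le_iff.2 (le_oplus_right x y)

theorem tsub_le_neg (x y : A) : Le (tsub x y) (∼y) :=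
  tsub_le_iff.2 (by rw [neg_oplus_self]; exact le_neg_zero x)

theorem tsub_tsub (x y z : A) : tsub (tsub x y) z = tsub x (y ⊕ᴹ z) := by
  rw [tsub, neg_tsub, oplus_assoc, tsub]

/-- Cancellation for sums without overflow. -/
theorem oplus_tsub_cancel {a b : A} (h : Le a (∼b)) : tsub (a ⊕ᴹ b) b = a := by
  apply neg_inj
  rw [neg_tsub]
  have := (le_neg_comm h).tsub_oplus
  rwa [tsub, neg_neg] at this

/-- Here `tsub a (∼b)` is the Łukasiewicz product, read as `a + b - 1` truncated at zero. It is the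
remainder after a carry in Chang's group. -/
theorem tsub_neg_comm (a b : A) : tsub a (∼b) = tsub b (∼a) := by
  rw [tsub, tsub, oplus_comm]

/-- This and the next two lemmas are the cases of associativity of addition with carry, according to
which of `a + b` and `b + c` reach `1`. -/
theorem oplus_tsub_neg {a b c : A} (hab : Le a (∼b)) (hbc : Le b (∼c)) :
    tsub (a ⊕ᴹ b) (∼c) = tsub a (∼(b ⊕ᴹ c)) := by
  have h : ∼c = b ⊕ᴹ ∼(b ⊕ᴹ c) := by
    rw [← hbc.tsub_oplus, tsub, neg_neg, oplus_comm, oplus_comm c]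
  rw [h, ← tsub_tsub, oplus_tsub_cancel hab]

theorem oplus_tsub_neg_of_overflow {a b c : A} (hab : Le a (∼b)) (hbc : Le (∼c) b) :
    tsub (a ⊕ᴹ b) (∼c) = a ⊕ᴹ tsub b (∼c) := by
  have h : Le (a ⊕ᴹ tsub b (∼c)) (∼∼c) := by
    refine (hab.oplus_right _).trans ?_
    have h1 : ∼b ⊕ᴹ tsub b (∼c) = c := by
      rw [oplus_comm, tsub_neg_comm, (neg_le_comm hbc).tsub_oplus]
    rw [h1, neg_neg]
    exact Le.refl c
  rw [← oplus_tsub_cancel h, oplus_assoc, hbc.tsub_oplus]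

theorem tsub_neg_oplus {a b c : A} (hab : Le (∼a) b) (hbc : Le (∼b) c) :
    tsub a (∼b) ⊕ᴹ c = a ⊕ᴹ tsub b (∼c) := by
  apply neg_inj
  have := oplus_tsub_neg (a := ∼a) (b := ∼b) (c := ∼c) (by rwa [neg_neg]) (by rwa [neg_neg])
  simpa only [tsub, neg_neg] using this

theorem tsub_neg_assoc (a b c : A) : tsub (tsub a (∼b)) (∼c) = tsub a (∼(tsub b (∼c))) := by
  rw [tsub_tsub, neg_tsub]

theorem tsub_neg_mono_left {a b : A} (h : Le a b) (c : A) : Le (tsub a (∼c)) (tsub b (∼c)) :=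
  (h.neg.oplus_right _).neg

theorem Le.oplus {x x' y y' : A} (h : Le x x') (h' : Le y y') : Le (x ⊕ᴹ y) (x' ⊕ᴹ y') :=
  (h.oplus_right y).trans (h'.oplus_left x')

theorem tsub_oplus_le {x y z : A} (h : Le x z) (h' : Le y z) : Le (tsub x y ⊕ᴹ y) z := by
  rw [← h'.tsub_oplus]
  exact (h.neg.oplus_right y).neg.oplus_right y

/-- Both sides are the meet of `x` and `y`, obtained from the join by De Morgan. -/
theorem tsub_tsub_self_comm (x y : A) : tsub x (tsub x y) = tsub y (tsub y x) := by
  have e : ∀ x y : A, tsub x (tsub x y) = ∼(tsub (∼y) (∼x) ⊕ᴹ ∼x) := fun x y => by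
    simp only [tsub, neg_neg]
    rw [oplus_comm (∼x) y, oplus_comm]
  rw [e, e, tsub_oplus_comm]

theorem le_tsub_tsub_self {x y z : A} (h : Le z x) (h' : Le z y) : Le z (tsub x (tsub x y)) := by
  have := tsub_oplus_le h'.neg h.neg
  replace this := le_neg_comm this
  simpa only [tsub, neg_neg, oplus_comm] using this

/-- Prelinearity. -/
theorem eq_zero_of_le_tsub {a b d : A} (h : Le d (tsub a b)) (h' : Le d (tsub b a)) : d = 𝟘 := by
  have hinf : ∀ x y : A, tsub x (tsub x (tsub x y)) = tsub x y := fun x y => by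
    have h1 : Le (tsub x y) (∼(tsub x (tsub x y))) := by
      rw [neg_tsub]
      exact le_oplus_left _ _
    have h2 := oplus_tsub_cancel h1
    rwa [oplus_comm, (tsub_le x y).tsub_oplus] at h2
  -- With `c` the meet of `a` and `b`, the sum `d ⊕ c` lies below both, hence below `c`. As `d ≤
  -- ¬c`, the sum does not overflow and cancelling `c` gives `d = 0`.
  set c := tsub a (tsub a b) with hc
  have hc' : c = tsub b (tsub b a) := tsub_tsub_self_comm a b
  have hca : Le c a := tsub_le _ _
  have hcb : Le c b := hc' ▸ tsub_le _ _
  have h1 : Le (d ⊕ᴹ c) a := by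
    rw [← hca.tsub_oplus, hinf]
    exact h.oplus_right c
  have h2 : Le (d ⊕ᴹ c) b := by
    rw [← hcb.tsub_oplus, hc', hinf, ← hc']
    exact h'.oplus_right c
  have h4 : Le d (∼c) := by
    refine h.trans ?_
    rw [← hinf a b]
    exact tsub_le_neg _ _
  rw [← oplus_tsub_cancel h4]
  exact le_tsub_tsub_self h1 h2

/-! ### Multiples, principal congruences and Archimedean chains -/

/-- Multiples of an element. -/
def nmul : ℕ → A → A
  | 0, _ => 𝟘
  | n + 1, b => nmul n b ⊕ᴹ b

theorem nmul_add (m n : ℕ) (b : A) : nmul (m + n) b = nmul m b ⊕ᴹ nmul n b := by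
  induction n with
  | zero => exact (oplus_zero _).symm
  | succ n ih => rw [← add_assoc, nmul, ih, oplus_assoc, nmul]

/-- The congruence generated by identifying `b` with zero. -/
def Congruence.ofElement (b : A) : Congruence A where
  rel x y := (∃ n, Le x (y ⊕ᴹ nmul n b)) ∧ ∃ n, Le y (x ⊕ᴹ nmul n b)
  equivalence := by
    have ht : ∀ {x y z : A}, (∃ n, Le x (y ⊕ᴹ nmul n b)) → (∃ n, Le y (z ⊕ᴹ nmul n b)) →
        ∃ n, Le x (z ⊕ᴹ nmul n b) := by
      rintro x y z ⟨m, hm⟩ ⟨n, hn⟩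
      refine ⟨n + m, hm.trans ?_⟩
      rw [nmul_add, ← oplus_assoc]
      exact hn.oplus_right _
    exact ⟨fun x => ⟨⟨0, le_oplus_right _ _⟩, ⟨0, le_oplus_right _ _⟩⟩, fun h => ⟨h.2, h.1⟩,
      fun h h' => ⟨ht h.1 h'.1, ht h'.2 h.2⟩⟩
  rel_oplus := by
    have ht : ∀ {x x' y y' : A}, (∃ n, Le x (x' ⊕ᴹ nmul n b)) → (∃ n, Le y (y' ⊕ᴹ nmul n b)) →
        ∃ n, Le (x ⊕ᴹ y) (x' ⊕ᴹ y' ⊕ᴹ nmul n b) := by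
      rintro x x' y y' ⟨m, hm⟩ ⟨n, hn⟩
      refine ⟨m + n, ?_⟩
      rw [nmul_add, oplus_assoc, oplus_left_comm y', ← oplus_assoc]
      exact hm.oplus hn
    exact fun _ _ _ _ h h' => ⟨ht h.1 h'.1, ht h.2 h'.2⟩
  rel_neg := by
    have ht : ∀ {x y : A}, (∃ n, Le x (y ⊕ᴹ nmul n b)) → ∃ n, Le (∼y) (∼x ⊕ᴹ nmul n b) := by
      rintro x y ⟨n, hn⟩
      refine ⟨n, ?_⟩
      rw [le_iff_neg] at hn ⊢
      rwa [neg_neg, oplus_left_comm]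
    exact fun _ _ h => ⟨ht h.2, ht h.1⟩

/-- The congruence generated by `b ~ 0` is not the identity, so simplicity makes it improper; that
`1` becomes `0` says that a multiple of `b` dominates `1`. -/
theorem IsSimple.exists_nmul_eq (h : IsSimple A) {b : A} (hb : b ≠ 𝟘) : ∃ n, nmul n b = ∼𝟘 := by
  have hb0 : (Congruence.ofElement b).rel b 𝟘 := by
    refine ⟨⟨1, ?_⟩, ⟨0, zero_le _⟩⟩
    rw [nmul, nmul, zero_oplus, zero_oplus]
    exact Le.refl b
  have hnp : ¬ (Congruence.ofElement b).IsProper := fun hp =>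
    hb (h.2 _ hp (fun x y (hxy : x = y) => hxy ▸ (Congruence.ofElement b).equivalence.refl x) _ _ hb0)
  have h1 : (Congruence.ofElement b).rel (∼𝟘) 𝟘 := by
    by_contra hn
    exact hnp ⟨_, _, hn⟩
  obtain ⟨⟨n, hn⟩, -⟩ := h1
  rw [zero_oplus] at hn
  exact ⟨n, hn.eq_neg_zero⟩

end Basic

/-- Archimedean MV-chains with at least two elements. -/
class IsArchimedeanChain (A : Type u) [MVAlgebra A] : Prop where
  total : ∀ x y : A, Le x y ∨ Le y x
  zero_ne : (𝟘 : A) ≠ ∼𝟘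
  exists_nmul_eq : ∀ b : A, b ≠ 𝟘 → ∃ n, nmul n b = ∼𝟘

theorem IsSimple.isArchimedeanChain {A : Type u} [MVAlgebra A] (h : IsSimple A) :
    IsArchimedeanChain A where
  total x y := by
    by_contra! hcon
    obtain ⟨n, hn⟩ := h.exists_nmul_eq (b := tsub x y) hcon.1
    -- By prelinearity `tsub y x` is disjoint from `tsub x y`, hence from all its multiples. One
    -- multiple is `1`, so `tsub y x` vanishes.
    have key : ∀ n, ∀ d, Le d (tsub y x) → Le d (nmul n (tsub x y)) → d = 𝟘 := by
      intro n
      induction n with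
      | zero => exact fun d _ h => h.eq_zero
      | succ n ih =>
        intro d hd hd'
        refine ih d hd ?_
        rw [nmul, oplus_comm] at hd'
        exact eq_zero_of_le_tsub (tsub_le_iff.2 hd') ((tsub_le _ _).trans hd)
    exact hcon.2 (key n _ (Le.refl _) (hn ▸ le_neg_zero _))
  zero_ne h0 := by
    obtain ⟨a, b, hab⟩ := h.1
    have : ∀ x : A, x = ∼𝟘 := fun x =>
      (oplus_zero x).symm.trans ((congrArg _ h0).trans (oplus_neg_zero x))
    exact hab ((this a).trans (this b).symm)
  exists_nmul_eq _ hb := h.exists_nmul_eq hb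

/-! ### Chang's group of an MV-chain -/

/-- The elements `whole + frac` of Chang's totally ordered group of an MV-chain, with
`0 ≤ frac < 1`. -/
@[ext]
structure ChangGroup (A : Type u) [MVAlgebra A] where
  whole : ℤ
  frac : A
  frac_ne : frac ≠ ∼𝟘

namespace ChangGroup

variable {A : Type u} [MVAlgebra A]

section Add

-- Addition with carry. A sum of fractional parts equal to `1`, exactly or by truncation, carries,
-- which keeps the new fractional part below `1`.
open scoped Classical in
noncomputable instance : Add (ChangGroup A) where
  add x y := if h : x.frac ⊕ᴹ y.frac = ∼𝟘 then
      ⟨x.whole + y.whole + 1, tsub x.frac (∼y.frac), fun h' =>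
        x.frac_ne (Le.eq_neg_zero (h' ▸ tsub_le _ _))⟩
    else ⟨x.whole + y.whole, x.frac ⊕ᴹ y.frac, h⟩

variable {x y z : ChangGroup A}

theorem whole_add_of_eq (h : x.frac ⊕ᴹ y.frac = ∼𝟘) : (x + y).whole = x.whole + y.whole + 1 :=
  congrArg whole (dif_pos h)

theorem frac_add_of_eq (h : x.frac ⊕ᴹ y.frac = ∼𝟘) : (x + y).frac = tsub x.frac (∼y.frac) :=
  congrArg frac (dif_pos h)

theorem whole_add_of_ne (h : x.frac ⊕ᴹ y.frac ≠ ∼𝟘) : (x + y).whole = x.whole + y.whole :=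
  congrArg whole (dif_neg h)

theorem frac_add_of_ne (h : x.frac ⊕ᴹ y.frac ≠ ∼𝟘) : (x + y).frac = x.frac ⊕ᴹ y.frac :=
  congrArg frac (dif_neg h)

protected theorem add_comm (x y : ChangGroup A) : x + y = y + x := by
  by_cases h : x.frac ⊕ᴹ y.frac = ∼𝟘
  · have h' := h
    rw [oplus_comm] at h'
    ext
    · rw [whole_add_of_eq h, whole_add_of_eq h', add_comm x.whole]
    · rw [frac_add_of_eq h, frac_add_of_eq h', tsub_neg_comm]
  · have h' := h
    rw [oplus_comm] at h'
    ext
    · rw [whole_add_of_ne h, whole_add_of_ne h', add_comm]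
    · rw [frac_add_of_ne h, frac_add_of_ne h', oplus_comm]

variable [IsArchimedeanChain A]

theorem le_neg_of_ne {a b : A} (h : a ⊕ᴹ b ≠ ∼𝟘) : Le a (∼b) :=
  le_neg_comm ((IsArchimedeanChain.total _ _).resolve_left fun h' => h (neg_le_iff.1 h'))

theorem add_assoc_of_ne (h1 : x.frac ⊕ᴹ y.frac ≠ ∼𝟘) : x + y + z = x + (y + z) := by
  have e1 := frac_add_of_ne h1
  have w1 := whole_add_of_ne h1
  by_cases h2 : y.frac ⊕ᴹ z.frac = ∼𝟘
  · have e2 := frac_add_of_eq h2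
    have w2 := whole_add_of_eq h2
    have h3 : (x + y).frac ⊕ᴹ z.frac = ∼𝟘 := by rw [e1, oplus_assoc, h2, oplus_neg_zero]
    have h4 : tsub (x.frac ⊕ᴹ y.frac) (∼z.frac) = x.frac ⊕ᴹ tsub y.frac (∼z.frac) :=
      oplus_tsub_neg_of_overflow (le_neg_of_ne h1) (by rwa [neg_le_iff, oplus_comm])
    have h5 : x.frac ⊕ᴹ (y + z).frac ≠ ∼𝟘 := by
      rw [e2, ← h4, tsub_neg_comm]
      exact fun h => z.frac_ne (Le.eq_neg_zero (h ▸ tsub_le _ _))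
    ext
    · rw [whole_add_of_eq h3, whole_add_of_ne h5, w1, w2]
      ring
    · rw [frac_add_of_eq h3, frac_add_of_ne h5, e1, e2, h4]
  · have e2 := frac_add_of_ne h2
    have w2 := whole_add_of_ne h2
    by_cases h3 : (x + y).frac ⊕ᴹ z.frac = ∼𝟘
    · have h4 : x.frac ⊕ᴹ (y + z).frac = ∼𝟘 := by rwa [e2, ← oplus_assoc, ← e1]
      ext
      · rw [whole_add_of_eq h3, whole_add_of_eq h4, w1, w2]
        ring
      · rw [frac_add_of_eq h3, frac_add_of_eq h4, e1, e2,
          oplus_tsub_neg (le_neg_of_ne h1) (le_neg_of_ne h2)]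
    · have h4 : x.frac ⊕ᴹ (y + z).frac ≠ ∼𝟘 := by rwa [e2, ← oplus_assoc, ← e1]
      ext
      · rw [whole_add_of_ne h3, whole_add_of_ne h4, w1, w2]
        ring
      · rw [frac_add_of_ne h3, frac_add_of_ne h4, e1, e2, oplus_assoc]

protected theorem add_assoc (x y z : ChangGroup A) : x + y + z = x + (y + z) := by
  by_cases h1 : x.frac ⊕ᴹ y.frac = ∼𝟘
  · by_cases h2 : y.frac ⊕ᴹ z.frac = ∼𝟘
    · have e1 := frac_add_of_eq h1
      have w1 := whole_add_of_eq h1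
      have e2 := frac_add_of_eq h2
      have w2 := whole_add_of_eq h2
      have e := tsub_neg_oplus (neg_le_iff.2 h1) (neg_le_iff.2 h2)
      rw [← e1, ← e2] at e
      by_cases h3 : (x + y).frac ⊕ᴹ z.frac = ∼𝟘
      · have h4 : x.frac ⊕ᴹ (y + z).frac = ∼𝟘 := by rwa [← e]
        ext
        · rw [whole_add_of_eq h3, whole_add_of_eq h4, w1, w2]
          ring
        · rw [frac_add_of_eq h3, frac_add_of_eq h4, e1, e2, tsub_neg_assoc]
      · have h4 : x.frac ⊕ᴹ (y + z).frac ≠ ∼𝟘 := by rwa [← e]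
        ext
        · rw [whole_add_of_ne h3, whole_add_of_ne h4, w1, w2]
          ring
        · rw [frac_add_of_ne h3, frac_add_of_ne h4, e]
    -- When only `x + y` carries, commutativity exchanges the outer summands and reduces to
    -- `add_assoc_of_ne`.
    · rw [oplus_comm] at h2
      rw [ChangGroup.add_comm x (y + z), ChangGroup.add_comm y z, add_assoc_of_ne h2,
        ChangGroup.add_comm z, ChangGroup.add_comm y x]
  · exact add_assoc_of_ne h1

end Add

variable [IsArchimedeanChain A]

instance : Zero (ChangGroup A) := ⟨⟨0, 𝟘, IsArchimedeanChain.zero_ne⟩⟩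

instance : One (ChangGroup A) := ⟨⟨1, 𝟘, IsArchimedeanChain.zero_ne⟩⟩

protected theorem zero_add (x : ChangGroup A) : 0 + x = x := by
  have h : (0 : ChangGroup A).frac ⊕ᴹ x.frac ≠ ∼𝟘 := by
    change 𝟘 ⊕ᴹ x.frac ≠ ∼𝟘
    rw [zero_oplus]
    exact x.frac_ne
  ext
  · rw [whole_add_of_ne h]
    exact zero_add _
  · rw [frac_add_of_ne h]
    exact zero_oplus _

open scoped Classical in
noncomputable instance : Neg (ChangGroup A) where
  neg x := if h : x.frac = 𝟘 then ⟨-x.whole, 𝟘, IsArchimedeanChain.zero_ne⟩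
    else ⟨-x.whole - 1, ∼x.frac, fun h' => h (neg_inj h')⟩

protected theorem neg_add_cancel (x : ChangGroup A) : -x + x = 0 := by
  by_cases h : x.frac = 𝟘
  · have e : -x = ⟨-x.whole, 𝟘, IsArchimedeanChain.zero_ne⟩ := dif_pos h
    have h' : (-x).frac ⊕ᴹ x.frac ≠ ∼𝟘 := by
      rw [e, h, oplus_zero]
      exact IsArchimedeanChain.zero_ne
    ext
    · rw [whole_add_of_ne h', e]
      exact neg_add_cancel _
    · rw [frac_add_of_ne h', e, h]
      exact oplus_zero _
  · have e : -x = ⟨-x.whole - 1, ∼x.frac, fun h' => h (neg_inj h')⟩ := dif_neg h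
    have h' : (-x).frac ⊕ᴹ x.frac = ∼𝟘 := by
      rw [e]
      exact neg_oplus_self _
    ext
    · rw [whole_add_of_eq h', e]
      change -x.whole - 1 + x.whole + 1 = 0
      ring
    · rw [frac_add_of_eq h', e]
      exact Le.refl _

noncomputable instance : AddCommGroup (ChangGroup A) where
  add_assoc := ChangGroup.add_assoc
  zero_add := ChangGroup.zero_add
  add_zero x := by rw [ChangGroup.add_comm, ChangGroup.zero_add]
  nsmul := nsmulRec
  zsmul := zsmulRec
  neg_add_cancel := ChangGroup.neg_add_cancel
  add_comm := ChangGroup.add_comm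

noncomputable instance : LinearOrder (ChangGroup A) where
  le x y := x.whole < y.whole ∨ x.whole = y.whole ∧ Le x.frac y.frac
  le_refl x := Or.inr ⟨rfl, Le.refl _⟩
  le_trans x y z := by
    rintro (h | ⟨h, h1⟩) (h' | ⟨h', h2⟩)
    · exact Or.inl (h.trans h')
    · exact Or.inl (h'.symm ▸ h)
    · exact Or.inl (h.symm ▸ h')
    · exact Or.inr ⟨h.trans h', h1.trans h2⟩
  le_antisymm x y := by
    rintro (h | ⟨h, h1⟩) (h' | ⟨h', h2⟩)
    · omega
    · omega
    · omega
    · exact ChangGroup.ext h (h1.antisymm h2)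
  le_total x y := by
    rcases lt_trichotomy x.whole y.whole with h | h | h
    · exact Or.inl (Or.inl h)
    · rcases IsArchimedeanChain.total x.frac y.frac with h' | h'
      · exact Or.inl (Or.inr ⟨h, h'⟩)
      · exact Or.inr (Or.inr ⟨h.symm, h'⟩)
    · exact Or.inr (Or.inl h)
  toDecidableLE := Classical.decRel _

theorem le_def {x y : ChangGroup A} :
    x ≤ y ↔ x.whole < y.whole ∨ x.whole = y.whole ∧ Le x.frac y.frac := Iff.rfl

instance : IsOrderedAddMonoid (ChangGroup A) where
  add_le_add_left x y h z := by
    rw [le_def] at h ⊢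
    by_cases h1 : x.frac ⊕ᴹ z.frac = ∼𝟘 <;> by_cases h2 : y.frac ⊕ᴹ z.frac = ∼𝟘
    · rw [whole_add_of_eq h1, whole_add_of_eq h2, frac_add_of_eq h1, frac_add_of_eq h2]
      rcases h with h | ⟨h, h'⟩
      · left; omega
      · exact Or.inr ⟨by rw [h], tsub_neg_mono_left h' _⟩
    · rw [whole_add_of_eq h1, whole_add_of_ne h2, frac_add_of_eq h1, frac_add_of_ne h2]
      rcases h with h | ⟨h, h'⟩
      -- A carry on the smaller side alone can make the whole parts equal; then the left fractional
      -- part is at most that of `z`, which is at most the right one.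
      · rcases (Int.add_one_le_of_lt h).lt_or_eq with h3 | h3
        · left; omega
        · refine Or.inr ⟨by omega, ?_⟩
          rw [tsub_neg_comm]
          exact (tsub_le _ _).trans (le_oplus_left _ _)
      · exact absurd (Le.eq_neg_zero (h1 ▸ h'.oplus_right z.frac)) h2
    · rw [whole_add_of_ne h1, whole_add_of_eq h2]
      left
      rcases h with h | ⟨h, -⟩ <;> omega
    · rw [whole_add_of_ne h1, whole_add_of_ne h2, frac_add_of_ne h1, frac_add_of_ne h2]
      rcases h with h | ⟨h, h'⟩
      · left; omega
      · exact Or.inr ⟨by rw [h], h'.oplus_right _⟩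

instance : ZeroLEOneClass (ChangGroup A) := ⟨Or.inl Int.zero_lt_one⟩

instance : NeZero (1 : ChangGroup A) := ⟨fun h => one_ne_zero (congrArg ChangGroup.whole h)⟩

theorem one_le_iff {x : ChangGroup A} : 1 ≤ x ↔ 1 ≤ x.whole := by
  rw [le_def]
  change 1 < x.whole ∨ 1 = x.whole ∧ Le 𝟘 x.frac ↔ _
  have := zero_le x.frac
  constructor
  · rintro (h | ⟨h, -⟩) <;> omega
  · intro h
    rcases h.lt_or_eq with h | h
    · exact Or.inl h
    · exact Or.inr ⟨h, this⟩

theorem whole_nsmul_one (n : ℕ) : (n • (1 : ChangGroup A)).whole = n ∧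
    (n • (1 : ChangGroup A)).frac = 𝟘 := by
  induction n with
  | zero => rw [zero_nsmul]; exact ⟨rfl, rfl⟩
  | succ n ih =>
    have h : (n • (1 : ChangGroup A)).frac ⊕ᴹ (1 : ChangGroup A).frac ≠ ∼𝟘 := by
      rw [ih.2, zero_oplus]
      exact IsArchimedeanChain.zero_ne
    rw [succ_nsmul, whole_add_of_ne h, frac_add_of_ne h, ih.1, ih.2, zero_oplus]
    exact ⟨by push_cast; rfl, rfl⟩

theorem one_le_nsmul_or {y : ChangGroup A} (hy : y.whole = 0) (n : ℕ) :
    1 ≤ n • y ∨ (n • y).whole = 0 ∧ (n • y).frac = nmul n y.frac := by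
  induction n with
  | zero => rw [zero_nsmul]; exact Or.inr ⟨rfl, rfl⟩
  | succ n ih =>
    rw [succ_nsmul]
    rcases ih with h | ⟨h, h'⟩
    · exact Or.inl (le_add_of_le_of_nonneg h (le_def.2 (Or.inr ⟨hy.symm, zero_le y.frac⟩)))
    · by_cases h1 : (n • y).frac ⊕ᴹ y.frac = ∼𝟘
      · left
        rw [one_le_iff, whole_add_of_eq h1]
        omega
      · right
        rw [whole_add_of_ne h1, frac_add_of_ne h1, h, hy, h']
        exact ⟨rfl, rfl⟩

/-- It suffices that a positive `y` has a multiple above `1`. If its whole part is `0`, some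
multiple of its nonzero fractional part is `1` in `A`, which no fractional part can be, so a carry
has occurred. -/
instance : Archimedean (ChangGroup A) where
  arch x y hy := by
    obtain ⟨k, hk⟩ : ∃ k : ℕ, 1 ≤ k • y := by
      rcases le_def.1 hy.le with h | ⟨h, -⟩
      · exact ⟨1, by rw [one_nsmul, one_le_iff]; exact h⟩
      · have hf : y.frac ≠ 𝟘 := fun hf => hy.ne (ChangGroup.ext h hf.symm)
        obtain ⟨n, hn⟩ := IsArchimedeanChain.exists_nmul_eq _ hf
        exact ⟨n, (one_le_nsmul_or h.symm n).resolve_right fun h' =>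
          (n • y).frac_ne (h'.2.trans hn)⟩
    refine ⟨(x.whole + 1).toNat * k, ?_⟩
    rw [mul_nsmul']
    refine le_trans ?_ (nsmul_le_nsmul_right hk _)
    rw [le_def, (whole_nsmul_one _).1]
    left
    omega

open scoped Classical in
/-- The embedding of an MV-chain into the unit interval of its group. -/
noncomputable def ofMV (a : A) : ChangGroup A := if h : a = ∼𝟘 then 1 else ⟨0, a, h⟩

theorem ofMV_neg_zero : ofMV (∼𝟘 : A) = 1 := dif_pos rfl

theorem ofMV_of_ne {a : A} (h : a ≠ ∼𝟘) : ofMV a = ⟨0, a, h⟩ := dif_neg h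

theorem ofMV_zero : ofMV (𝟘 : A) = 0 := ofMV_of_ne IsArchimedeanChain.zero_ne

theorem ofMV_nonneg (a : A) : 0 ≤ ofMV a := by
  by_cases h : a = ∼𝟘
  · rw [h, ofMV_neg_zero]
    exact zero_le_one
  · rw [ofMV_of_ne h]
    exact Or.inr ⟨rfl, zero_le a⟩

theorem ofMV_le_one (a : A) : ofMV a ≤ 1 := by
  by_cases h : a = ∼𝟘
  · rw [h, ofMV_neg_zero]
  · rw [ofMV_of_ne h]
    exact Or.inl Int.zero_lt_one

theorem ofMV_oplus (a b : A) : ofMV (a ⊕ᴹ b) = min (ofMV a + ofMV b) 1 := by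
  by_cases ha : a = ∼𝟘
  · rw [ha, neg_zero_oplus, ofMV_neg_zero, min_eq_right]
    exact le_add_of_nonneg_right (ofMV_nonneg b)
  by_cases hb : b = ∼𝟘
  · rw [hb, oplus_neg_zero, ofMV_neg_zero, min_eq_right]
    exact le_add_of_nonneg_left (ofMV_nonneg a)
  rw [ofMV_of_ne ha, ofMV_of_ne hb]
  by_cases h : a ⊕ᴹ b = ∼𝟘
  · rw [h, ofMV_neg_zero, min_eq_right]
    rw [one_le_iff, whole_add_of_eq h]
    exact le_rfl
  · have e : (⟨0, a, ha⟩ + ⟨0, b, hb⟩ : ChangGroup A) = ofMV (a ⊕ᴹ b) := by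
      rw [ofMV_of_ne h]
      ext
      · exact whole_add_of_ne h
      · exact frac_add_of_ne h
    rw [e, min_eq_left (ofMV_le_one _)]

theorem ofMV_neg_add (a : A) : ofMV (∼a) + ofMV a = 1 := by
  by_cases ha : a = ∼𝟘
  · rw [ha, neg_neg, ofMV_zero, ofMV_neg_zero, zero_add]
  by_cases ha' : ∼a = ∼𝟘
  · rw [neg_inj ha', ofMV_zero, ofMV_neg_zero, add_zero]
  rw [ofMV_of_ne ha, ofMV_of_ne ha']
  have h := neg_oplus_self a
  ext
  · exact whole_add_of_eq h
  · refine (frac_add_of_eq h).trans ?_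
    exact Le.refl _

end ChangGroup

/-! ### Simple and semisimple MV-algebras -/

theorem coe_unit_zero : ((𝟘 : unitInterval) : ℝ) = 0 := rfl

theorem coe_unit_neg (x : unitInterval) : ((∼x : unitInterval) : ℝ) = 1 - x := rfl

theorem coe_unit_oplus (x y : unitInterval) : ((x ⊕ᴹ y : unitInterval) : ℝ) = min ((x : ℝ) + y) 1 :=
  rfl

theorem unit_zero_ne : (𝟘 : unitInterval) ≠ ∼𝟘 := fun h => by
  have := congrArg (fun x : unitInterval => (x : ℝ)) h
  simp only [coe_unit_neg, coe_unit_zero, sub_zero] at this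
  exact zero_ne_one this

/-- Every Archimedean chain has a homomorphism to `[0,1]`. -/
theorem IsArchimedeanChain.exists_isHom (A : Type u) [MVAlgebra A] [IsArchimedeanChain A] :
    ∃ f : A → unitInterval, IsHom f := by
  -- Hölder's embedding into the reals, normalised to send the unit to `1`.
  let e := Archimedean.embedReal (ChangGroup A)
  have he1 : e 1 = 1 := Archimedean.embedReal_one
  have hmono : Monotone e := e.monotone'
  refine ⟨fun a => ⟨e (ChangGroup.ofMV a), ?_, ?_⟩, ?_, ?_, ?_⟩
  · rw [← map_zero e]
    exact hmono (ChangGroup.ofMV_nonneg a)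
  · rw [← he1]
    exact hmono (ChangGroup.ofMV_le_one a)
  · apply Subtype.ext
    change e _ = 0
    rw [ChangGroup.ofMV_zero, map_zero]
  · intro a b
    apply Subtype.ext
    rw [coe_unit_oplus]
    change e _ = min (e _ + e _) 1
    rw [ChangGroup.ofMV_oplus, hmono.map_min, map_add, he1]
  · intro a
    apply Subtype.ext
    rw [coe_unit_neg]
    change e _ = 1 - e _
    rw [← he1, ← ChangGroup.ofMV_neg_add a, map_add, add_sub_cancel_right]

/-- The kernel of a homomorphism. -/
def IsHom.ker {A : Type u} {B : Type v} [MVAlgebra A] [MVAlgebra B] {f : A → B} (hf : IsHom f) :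
    Congruence A where
  rel a b := f a = f b
  equivalence := ⟨fun _ => rfl, Eq.symm, Eq.trans⟩
  rel_oplus a a' b b' h h' := by rw [hf.map_oplus, hf.map_oplus, h, h']
  rel_neg a a' h := by rw [hf.map_neg, hf.map_neg, h]

/-- The kernel of any homomorphism to `[0,1]` is proper since `0 ≠ 1` there, so simplicity makes it
the identity. -/
theorem IsSimple.exists_injective {A : Type u} [MVAlgebra A] (h : IsSimple A) :
    ∃ f : A → unitInterval, IsHom f ∧ Function.Injective f := by
  have := h.isArchimedeanChain
  obtain ⟨f, hf⟩ := IsArchimedeanChain.exists_isHom A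
  refine ⟨f, hf, fun a b hab => h.2 hf.ker ⟨𝟘, ∼𝟘, ?_⟩ ?_ a b hab⟩
  · change f 𝟘 ≠ f (∼𝟘)
    rw [hf.map_neg, hf.map_zero]
    exact unit_zero_ne
  · exact fun x y (hxy : x = y) => congrArg f hxy

theorem coe_map_nmul {A : Type u} [MVAlgebra A] {f : A → unitInterval} (hf : IsHom f) (n : ℕ)
    (d : A) : (f (nmul n d) : ℝ) = min (n * (f d : ℝ)) 1 := by
  induction n with
  | zero => simp [nmul, hf.map_zero, coe_unit_zero]
  | succ n ih =>
    rw [nmul, hf.map_oplus, coe_unit_oplus, ih]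
    have := (f d).2.1
    push_cast
    rcases le_total ((n : ℝ) * f d) 1 with h | h
    · rw [min_eq_left h, add_mul, one_mul]
    · rw [min_eq_right h, min_eq_right (by linarith), min_eq_right (by linarith)]

/-- If a congruence identifies `a` with `b` and `a ≰ b`, it identifies `tsub a b` with `0`. This
element has a positive real value, so a multiple of it is `1`, and everything collapses. -/
theorem isSimple_of_injective {A : Type u} [MVAlgebra A] {f : A → unitInterval} (hf : IsHom f)
    (hinj : Function.Injective f) : IsSimple A := by
  refine ⟨⟨𝟘, ∼𝟘, fun h => unit_zero_ne ?_⟩, fun ψ hψ _ => ?_⟩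
  · rw [← hf.map_zero, ← hf.map_neg]
    exact congrArg f h
  have key : ∀ a b, ψ.rel a b → Le a b := by
    intro a b hab
    by_contra hd
    have hd0 : ψ.rel (tsub a b) 𝟘 := by
      have := ψ.rel_neg _ _ (ψ.rel_oplus _ _ _ _ (ψ.rel_neg _ _ hab) (ψ.equivalence.refl b))
      rwa [neg_oplus_self, neg_neg] at this
    have hpos : 0 < (f (tsub a b) : ℝ) := by
      refine lt_of_le_of_ne (f _).2.1 fun h => hd (hinj ?_)
      rw [hf.map_zero]
      exact Subtype.ext h.symm
    obtain ⟨n, hn⟩ := Archimedean.arch (1 : ℝ) hpos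
    have hn1 : nmul n (tsub a b) = ∼𝟘 := by
      apply hinj
      apply Subtype.ext
      rw [coe_map_nmul hf, hf.map_neg, hf.map_zero, coe_unit_neg, coe_unit_zero, sub_zero]
      exact min_eq_right (by simpa using hn)
    have hn0 : ∀ n, ψ.rel (nmul n (tsub a b)) 𝟘 := by
      intro n
      induction n with
      | zero => exact ψ.equivalence.refl _
      | succ n ih =>
        have := ψ.rel_oplus _ _ _ _ ih hd0
        rwa [oplus_zero] at this
    have h1 : ψ.rel (∼𝟘) 𝟘 := hn1 ▸ hn0 n
    have hx : ∀ x, ψ.rel (∼𝟘) x := fun x => by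
      have := ψ.rel_oplus _ _ _ _ (ψ.equivalence.refl x) h1
      rwa [oplus_zero, oplus_neg_zero] at this
    obtain ⟨x, y, hxy⟩ := hψ
    exact hxy (ψ.equivalence.trans (ψ.equivalence.symm (hx x)) (hx y))
  exact fun a b hab => (key a b hab).antisymm (key b a (ψ.equivalence.symm hab))

/-- Needed because `IsSemisimple` takes its factors in the universe of `A`, whereas `[0,1]` lives in
the lowest one. -/
instance instULift {A : Type u} [MVAlgebra A] : MVAlgebra (ULift.{v} A) where
  oplus x y := ⟨x.down ⊕ᴹ y.down⟩
  neg x := ⟨∼x.down⟩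
  zero := ⟨𝟘⟩
  oplus_assoc _ _ _ := ULift.ext _ _ (oplus_assoc _ _ _)
  oplus_comm _ _ := ULift.ext _ _ (oplus_comm _ _)
  oplus_zero _ := ULift.ext _ _ (oplus_zero _)
  neg_neg _ := ULift.ext _ _ (neg_neg _)
  oplus_neg_zero _ := ULift.ext _ _ (oplus_neg_zero _)
  lukasiewicz _ _ := ULift.ext _ _ (lukasiewicz _ _)

/-- The range of a homomorphism. -/
def IsHom.range {A : Type u} {B : Type v} [MVAlgebra A] [MVAlgebra B] {f : A → B} (hf : IsHom f) :
    Subalgebra B where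
  carrier := Set.range f
  zero_mem := ⟨𝟘, hf.map_zero⟩
  oplus_mem := by
    rintro _ _ ⟨a, rfl⟩ ⟨b, rfl⟩
    exact ⟨_, hf.map_oplus a b⟩
  neg_mem := by
    rintro _ ⟨a, rfl⟩
    exact ⟨_, hf.map_neg a⟩

/-- An MV-algebra is semisimple if and only if its homomorphisms to `[0,1]` separate its points. -/
theorem isSemisimple_iff {A : Type u} [MVAlgebra A] :
    IsSemisimple A ↔ ∀ a b, (∀ p ∈ dualSpace A, p a = p b) → a = b := by
  constructor
  · rintro ⟨ι, B, _, hB, f, hf, hinj, -⟩ a b hab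
    refine hinj (funext fun i => ?_)
    obtain ⟨g, hg, hg'⟩ := (hB i).exists_injective
    refine hg' (hab (fun a => g (f a i)) ⟨?_, fun a b => ?_, fun a => ?_⟩)
    · rw [hf.map_zero]
      exact hg.map_zero
    · rw [hf.map_oplus]
      exact hg.map_oplus _ _
    · rw [hf.map_neg]
      exact hg.map_neg _
  · intro h
    have hup : ∀ p : dualSpace A, IsHom fun a => (ULift.up (p.1 a) : ULift.{u} unitInterval) :=
      fun p => ⟨congrArg _ p.2.map_zero, fun a b => congrArg _ (p.2.map_oplus a b),
        fun a => congrArg _ (p.2.map_neg a)⟩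
    -- The factors are the images of `A` in `[0,1]`, one for each homomorphism; corestricting to
    -- images makes the product subdirect.
    refine ⟨dualSpace A, fun p => (hup p).range.carrier, fun p => inferInstance, fun p => ?_,
      fun a p => ⟨_, a, rfl⟩, ⟨?_, fun a b => ?_, fun a => ?_⟩, fun a b hab => ?_, ?_⟩
    · exact isSimple_of_injective (f := fun x => x.1.down) ⟨rfl, fun _ _ => rfl, fun _ => rfl⟩
        fun x y hxy => Subtype.ext (ULift.ext _ _ hxy)
    · exact funext fun p => Subtype.ext (hup p).map_zero
    · exact funext fun p => Subtype.ext ((hup p).map_oplus a b)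
    · exact funext fun p => Subtype.ext ((hup p).map_neg a)
    · refine h a b fun p hp => ?_
      exact congrArg (fun x => x.1.down) (congrFun hab ⟨p, hp⟩)
    · rintro p ⟨_, a, rfl⟩
      exact ⟨a, rfl⟩

end MVAlgebra

/-! ### The equivalences -/

namespace MVAlgebra

theorem continuous_unit_neg : Continuous (neg : unitInterval → unitInterval) :=
  Continuous.subtype_mk (continuous_const.sub continuous_subtype_val) _

theorem continuous_unit_oplus :
    Continuous fun x : unitInterval × unitInterval => oplus x.1 x.2 :=
  Continuous.subtype_mk
    (((continuous_subtype_val.comp continuous_fst).add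
      (continuous_subtype_val.comp continuous_snd)).min continuous_const) _

/-- Being a homomorphism on a subalgebra is a closed condition. -/
theorem isClosed_setOf_isHom_restrict {A : Type u} {B : Type v} [MVAlgebra B] (i : B → A) :
    IsClosed {p : A → unitInterval | IsHom fun b => p (i b)} := by
  have e : {p : A → unitInterval | IsHom fun b => p (i b)} =
      {p | p (i zero) = zero} ∩ ((⋂ a : B, ⋂ b : B,
        {p | p (i (oplus a b)) = oplus (p (i a)) (p (i b))}) ∩
        ⋂ a : B, {p | p (i (neg a)) = neg (p (i a))}) := by
    ext p
    simp only [Set.mem_inter_iff, Set.mem_iInter, Set.mem_ofPred_eq]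
    exact ⟨fun h => ⟨h.map_zero, h.map_oplus, h.map_neg⟩, fun h => ⟨h.1, h.2.1, h.2.2⟩⟩
  rw [e]
  refine (isClosed_eq (continuous_apply _) continuous_const).inter
    ((isClosed_iInter fun a => isClosed_iInter fun b => isClosed_eq (continuous_apply _) ?_).inter
      (isClosed_iInter fun a => isClosed_eq (continuous_apply _) ?_))
  · exact Continuous.comp continuous_unit_oplus (f := fun p : A → unitInterval => (p (i a), p (i b)))
      ((continuous_apply (i a)).prodMk (continuous_apply (i b)))
  · exact continuous_unit_neg.comp (continuous_apply (i a))

theorem isClosed_dualSpace (A : Type u) [MVAlgebra A] : IsClosed (dualSpace A) :=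
  isClosed_setOf_isHom_restrict (fun a : A => a)

end MVAlgebra

theorem IsZMap.continuous {I : Type u} {X : Set (I → unitInterval)} {g : X → unitInterval}
    (hg : IsZMap X g) : Continuous g := by
  obtain ⟨ξ, ⟨I', f, ⟨hf, -⟩, h⟩, hξ⟩ := hg
  have e : g = fun p : X => f fun i => p.1 i := funext fun p => (hξ p).trans (h p)
  rw [e]
  exact hf.comp (continuous_pi fun i => (continuous_apply _).comp continuous_subtype_val)

theorem isZMap_apply {I : Type u} (X : Set (I → unitInterval)) (i : I) :
    IsZMap X fun p => p.1 i := by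
  classical
  refine ⟨fun p => p i, ⟨{i}, fun x => x ⟨i, Finset.mem_singleton_self i⟩,
    ⟨continuous_apply _, {(Pi.single ⟨i, Finset.mem_singleton_self i⟩ 1, 0)}, fun x =>
      ⟨_, Finset.mem_singleton_self _, ?_⟩⟩, fun _ => rfl⟩, fun _ => rfl⟩
  rw [Finset.sum_eq_single ⟨i, Finset.mem_singleton_self i⟩]
  · simp
  · intro j _ hj
    simp [hj]
  · exact fun h => absurd (Finset.mem_univ _) h

namespace MVAlgebra

/-- Evaluations at the points of `X` form a compact separating set of homomorphisms, and on finitely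
many elements they are given by terms applied to the points of `X`. -/
theorem IsPolyhedral.isSemisimple_and {A : Type u} [MVAlgebra A] (h : IsPolyhedral A) :
    IsSemisimple A ∧ IsInfinitePolyhedron (dualSpace A) := by
  obtain ⟨Y, X, hX, hP, φ, hφ, hbij⟩ := h
  have : CompactSpace X := isCompact_iff_compactSpace.1 hX.isCompact
  let ev : X → A → unitInterval := fun x a => (φ a).1 x
  have hev : Continuous ev := continuous_pi fun a => IsZMap.continuous (φ a).2
  have hdual : Set.range ev ⊆ dualSpace A := by
    rintro _ ⟨x, rfl⟩
    refine ⟨?_, fun a b => ?_, fun a => ?_⟩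
    · change (φ zero).1 x = zero
      rw [hφ.map_zero]
      rfl
    · change (φ (oplus a b)).1 x = _
      rw [hφ.map_oplus]
      rfl
    · change (φ (neg a)).1 x = _
      rw [hφ.map_neg]
      rfl
  have hsep : ∀ a b, (∀ p ∈ Set.range ev, p a = p b) → a = b := fun a b hab =>
    hbij.1 (Subtype.ext (funext fun x => hab _ ⟨x, rfl⟩))
  refine ⟨isSemisimple_iff.2 fun a b hab => hsep a b fun p hp => hab p (hdual hp), fun Z => ?_⟩
  choose t ht using fun z : Z => IsZMap.exists_term (φ z.1).2
  convert hP.isPolyhedron_image_eval t using 1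
  refine (image_dualSpace_eq (isCompact_range hev) hdual hsep (i := fun a : A => a)
    ⟨rfl, fun _ _ => rfl, fun _ => rfl⟩ (fun _ _ h => h) (fun z : Z => z.1)).trans ?_
  ext y
  constructor
  · rintro ⟨_, ⟨x, rfl⟩, rfl⟩
    exact ⟨x.1, x.2, funext fun z => congrArg Subtype.val (ht z x).symm⟩
  · rintro ⟨x, hx, rfl⟩
    exact ⟨_, ⟨⟨x, hx⟩, rfl⟩, funext fun z => congrArg Subtype.val (ht z ⟨x, hx⟩)⟩

/-- A semisimple MV-algebra is isomorphic to the algebra of `ℤ`-maps on its dual space. -/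
theorem IsSemisimple.isomorphic_McN {A : Type u} [MVAlgebra A] (h : IsSemisimple A) :
    Isomorphic A (McN (dualSpace A)).carrier := by
  refine ⟨fun a => ⟨fun p => p.1 a, isZMap_apply _ a⟩, ⟨?_, fun a b => ?_, fun a => ?_⟩,
    fun a b hab => ?_, ?_⟩
  · exact Subtype.ext (funext fun p => p.2.map_zero)
  · exact Subtype.ext (funext fun p => p.2.map_oplus a b)
  · exact Subtype.ext (funext fun p => p.2.map_neg a)
  · exact isSemisimple_iff.1 h a b fun p hp =>
      congrFun (congrArg Subtype.val hab) (⟨p, hp⟩ : dualSpace A)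
  -- A `ℤ`-map is a term in the elements of `A` as variables; evaluating that term in `A` itself
  -- gives a preimage.
  · rintro ⟨g, hg⟩
    obtain ⟨t, ht⟩ := IsZMap.exists_term hg
    exact ⟨t.eval fun a => a, Subtype.ext (funext fun p =>
      (p.2.map_eval _ t).trans (ht p).symm)⟩

theorem isPolyhedral_iff {A : Type u} [MVAlgebra A] :
    IsPolyhedral A ↔ IsSemisimple A ∧ IsInfinitePolyhedron (dualSpace A) :=
  ⟨IsPolyhedral.isSemisimple_and,
    fun h => ⟨A, dualSpace A, isClosed_dualSpace A, h.2, h.1.isomorphic_McN⟩⟩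

/-- Subalgebras of polyhedral algebras are polyhedral. -/
theorem IsPolyhedral.subalgebra {A : Type u} [MVAlgebra A] (h : IsPolyhedral A)
    (B : Subalgebra A) : IsPolyhedral B.carrier := by
  rw [isPolyhedral_iff] at h ⊢
  have hsep := isSemisimple_iff.1 h.1
  refine ⟨isSemisimple_iff.2 fun a b hab => Subtype.ext (hsep _ _ fun p hp => ?_), fun Z => ?_⟩
  · exact hab _ (IsHom.comp hp (isHom_val B))
  · convert h.2.isPolyhedron_image_eval (fun z : Z => MVTerm.var z.1.1) using 1
    exact image_dualSpace_eq (isClosed_dualSpace A).isCompact subset_rfl hsep (isHom_val B)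
      Subtype.val_injective fun z : Z => z.1

/-! ### Passage from finitely generated subalgebras to the whole algebra -/

namespace Subalgebra

variable {A : Type u} [MVAlgebra A]

theorem subset_generatedBy (C : Set A) : C ⊆ (generatedBy C).carrier := fun _ ha _ hT => hT ha

theorem generatedBy_mono {C D : Set A} (h : C ⊆ D) :
    (generatedBy C).carrier ⊆ (generatedBy D).carrier := fun _ ha T hT => ha T (h.trans hT)

theorem isHom_inclusion {S T : Subalgebra A} (h : S.carrier ⊆ T.carrier) :
    IsHom (Set.inclusion h) :=
  ⟨rfl, fun _ _ => rfl, fun _ => rfl⟩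

theorem isFinitelyGenerated_generatedBy {C : Set A} (hC : C.Finite) :
    (generatedBy C).IsFinitelyGenerated :=
  ⟨C, hC, rfl⟩

end Subalgebra

/-- Semisimplicity is a local property. -/
theorem isSemisimple_of_forall_finitelyGenerated {A : Type u} [MVAlgebra A]
    (h : ∀ B : Subalgebra A, B.IsFinitelyGenerated → IsSemisimple B.carrier) :
    IsSemisimple A := by
  classical
  refine isSemisimple_iff.2 fun a b hab => ?_
  by_contra hne
  let C : Finset A → Subalgebra A := fun Z =>
    Subalgebra.generatedBy (insert a (insert b (Z : Set A)))
  have hCfg : ∀ Z, (C Z).IsFinitelyGenerated := fun Z =>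
    Subalgebra.isFinitelyGenerated_generatedBy ((Z.finite_toSet.insert b).insert a)
  have hCmono : ∀ {Z Z' : Finset A}, Z ⊆ Z' → (C Z).carrier ⊆ (C Z').carrier := fun h =>
    Subalgebra.generatedBy_mono (Set.insert_subset_insert (Set.insert_subset_insert
      (Finset.coe_subset.2 h)))
  have hCsub : ∀ Z : Finset A, insert a (insert b (Z : Set A)) ⊆ (C Z).carrier := fun Z =>
    Subalgebra.subset_generatedBy _
  have haC : ∀ Z, a ∈ (C Z).carrier := fun Z => hCsub Z (Set.mem_insert _ _)
  have hbC : ∀ Z, b ∈ (C Z).carrier := fun Z =>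
    hCsub Z (Set.mem_insert_of_mem _ (Set.mem_insert _ _))
  obtain ⟨q, hq, hqne⟩ : ∃ q ∈ dualSpace (C ∅).carrier, q ⟨a, haC ∅⟩ ≠ q ⟨b, hbC ∅⟩ := by
    by_contra! hcon
    exact hne (congrArg Subtype.val (isSemisimple_iff.1 (h _ (hCfg ∅)) _ _ hcon))
  -- Functions that are homomorphisms on the subalgebra generated by `a`, `b` and `Z`, with the
  -- separating values of `q` prescribed at `a` and `b`. Membership in all `K Z` yields a
  -- homomorphism on `A` separating `a` from `b`.
  let K : Finset A → Set (A → unitInterval) := fun Z =>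
    {p | IsHom fun x : (C Z).carrier => p x.1} ∩
      ({p | p a = q ⟨a, haC ∅⟩} ∩ {p | p b = q ⟨b, hbC ∅⟩})
  have hKc : ∀ Z, IsClosed (K Z) := fun Z =>
    (isClosed_setOf_isHom_restrict _).inter
      ((isClosed_eq (continuous_apply _) continuous_const).inter
        (isClosed_eq (continuous_apply _) continuous_const))
  have hKanti : ∀ {Z Z' : Finset A}, Z ⊆ Z' → K Z' ⊆ K Z := fun {Z Z'} hZ p hp =>
    have hp1 : IsHom fun x : (C Z').carrier => p x.1 := hp.1
    ⟨hp1.comp (Subalgebra.isHom_inclusion (hCmono hZ)), hp.2⟩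
  have hKn : ∀ Z, (K Z).Nonempty := by
    intro Z
    -- `q` itself need not extend to `C Z`, but some homomorphism there agrees with it at the two
    -- elements `a` and `b`. Outside `C Z` the values are unconstrained, so `zero` serves.
    obtain ⟨p, hp, hpq⟩ := exists_mem_eq_of_isHom (isClosed_dualSpace (C Z).carrier).isCompact
      subset_rfl (isSemisimple_iff.1 (h _ (hCfg Z)))
      (Subalgebra.isHom_inclusion (hCmono (Finset.empty_subset Z)))
      (Set.inclusion_injective _) hq (fun k : Bool => if k then ⟨a, haC ∅⟩ else ⟨b, hbC ∅⟩)
    let p' : A → unitInterval := fun x => if hx : x ∈ (C Z).carrier then p ⟨x, hx⟩ else zero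
    have hp' : ∀ x : (C Z).carrier, p' x.1 = p x := fun x => dif_pos x.2
    refine ⟨p', ?_, ?_, ?_⟩
    · change IsHom fun x : (C Z).carrier => p' x.1
      rw [funext hp']
      exact hp
    · exact (hp' ⟨a, haC Z⟩).trans (hpq true)
    · exact (hp' ⟨b, hbC Z⟩).trans (hpq false)
  obtain ⟨p, hp⟩ := IsCompact.nonempty_iInter_of_directed_nonempty_isCompact_isClosed K
    (fun Z Z' => ⟨Z ∪ Z', hKanti Finset.subset_union_left, hKanti Finset.subset_union_right⟩)
    hKn (fun Z => (hKc Z).isCompact) hKc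
  rw [Set.mem_iInter] at hp
  have hmem : ∀ {Z : Finset A} {x}, x ∈ Z → x ∈ (C Z).carrier := fun hx =>
    hCsub _ (Set.mem_insert_of_mem _ (Set.mem_insert_of_mem _ (Finset.mem_coe.2 hx)))
  have hpd : p ∈ dualSpace A := by
    refine ⟨(hp ∅).1.map_zero, fun x y => ?_, fun x => ?_⟩
    · exact (hp {x, y}).1.map_oplus ⟨x, hmem (by simp)⟩ ⟨y, hmem (by simp)⟩
    · exact (hp {x}).1.map_neg ⟨x, hmem (by simp)⟩
  apply hqne
  rw [← (hp ∅).2.1, ← (hp ∅).2.2]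
  exact hab p hpd

/-- Once `A` is semisimple, the projection of its dual space to `Z` coincides with the projection of
the dual space of the subalgebra generated by `Z`. -/
theorem isPolyhedral_of_forall_finitelyGenerated {A : Type u} [MVAlgebra A]
    (h : ∀ B : Subalgebra A, B.IsFinitelyGenerated → IsPolyhedral B.carrier) :
    IsPolyhedral A := by
  have hss : IsSemisimple A :=
    isSemisimple_of_forall_finitelyGenerated fun B hB => (isPolyhedral_iff.1 (h B hB)).1
  refine isPolyhedral_iff.2 ⟨hss, fun Z => ?_⟩
  let B := Subalgebra.generatedBy (Z : Set A)
  let z : Z → B.carrier := fun z => ⟨z.1, Subalgebra.subset_generatedBy _ z.2⟩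
  have hB := (isPolyhedral_iff.1
    (h B (Subalgebra.isFinitelyGenerated_generatedBy Z.finite_toSet))).2
  convert hB.isPolyhedron_image_eval (fun k => MVTerm.var (z k)) using 1
  exact (image_dualSpace_eq (isClosed_dualSpace A).isCompact subset_rfl (isSemisimple_iff.1 hss)
    (isHom_val B) Subtype.val_injective z).symm

end MVAlgebra

theorem mainTheorem8 (A : Type u) [MVAlgebra A] :
    List.TFAE [
      MVAlgebra.IsPolyhedral A,
      MVAlgebra.IsSemisimple A ∧ IsInfinitePolyhedron (MVAlgebra.dualSpace A),
      ∀ B : MVAlgebra.Subalgebra A, B.IsFinitelyGenerated → MVAlgebra.IsPolyhedral B.carrier] := by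
  tfae_have 1 ↔ 2 := MVAlgebra.isPolyhedral_iff
  tfae_have 1 → 3 := fun h B _ => h.subalgebra B
  tfae_have 3 → 1 := MVAlgebra.isPolyhedral_of_forall_finitelyGenerated
  tfae_finish
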